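/- For $\Phi\in\mathbb{R}$ let $$Q_\Lambda(\Phi)=\frac13\begin{pmatrix}0&1+\tau_0+\tau_1\\(1+\tau_0+\tau_1)^*&0\end{pmatrix}$$ be the bounded self-adjoint operator on $\ell^2(\mathbb{Z}^2;\mathbb{C})\oplus\ell^2(\mathbb{Z}^2;\mathbb{C})$, where $(\tau_0u)_{\gamma_1,\gamma_2}=u_{\gamma_1-1,\gamma_2}$ and $(\tau_1u)_{\gamma_1,\gamma_2}=e^{-i\Phi\gamma_1}u_{\gamma_1,\gamma_2-1}$. Call $\Phi$ generic if $\frac{\Phi}{2\pi}$ is irrational and there are a constant $C$ and a sequence of reduced rationals $p_n/q_n$ with $q_n\to\infty$ such that $$q_n^4\left|\frac{\Phi}{2\pi}-\frac{p_n}{q_n}\right|<C\qquad\text{for all } n.$$ Then the set of generic $\Phi$ is residual (comeagre) in $\mathbb{R}$, and for every generic $\Phi$ the Hausdorff dimension of the spectrum satisfies $$\dim_H\sigma(Q_\Lambda(\Phi))\le\tfrac12 .$$ -/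

import Mathlib

open Filter Topology

noncomputable section

namespace HexQ

/-- The Hilbert space `ℓ²(ℤ²; ℂ)`. -/
abbrev EllTwo : Type := lp (fun _ : ℤ × ℤ => ℂ) 2

/-- Multiplying a square-summable family by unimodular phases and translating it by `d`
gives a square-summable family. -/
theorem memlp_phaseShift (w : ℤ × ℤ → ℂ) (hw : ∀ γ, ‖w γ‖ = 1) (d : ℤ × ℤ) (u : EllTwo) :
    Memℓp (fun γ : ℤ × ℤ => w γ * u (γ - d)) 2 := by
  have hu := lp.memℓp u
  rw [memℓp_gen_iff (by norm_num)] at hu ⊢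
  simp only [norm_mul, hw, one_mul]
  exact (Equiv.subRight d).summable_iff.mpr hu

/-- The magnetic translation `u ↦ (γ ↦ w γ * u (γ - d))` on `ℓ²(ℤ²; ℂ)`, for unimodular
phases `w`, as a linear isometry. -/
def phaseShift (w : ℤ × ℤ → ℂ) (hw : ∀ γ, ‖w γ‖ = 1) (d : ℤ × ℤ) : EllTwo →ₗᵢ[ℂ] EllTwo where
  toFun u := ⟨fun γ => w γ * u (γ - d), memlp_phaseShift w hw d u⟩
  map_add' u v := by
    ext γ
    exact mul_add (w γ) (u (γ - d)) (v (γ - d))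
  map_smul' c u := by
    ext γ
    exact mul_left_comm (w γ) c (u (γ - d))
  norm_map' u := by
    rw [lp.norm_eq_tsum_rpow (by norm_num), lp.norm_eq_tsum_rpow (by norm_num)]
    congr 1
    rw [← (Equiv.subRight d).tsum_eq (fun γ => ‖u γ‖ ^ (2 : ENNReal).toReal)]
    refine tsum_congr fun γ => ?_
    change ‖w γ * u (γ - d)‖ ^ _ = ‖u (γ - d)‖ ^ _
    rw [norm_mul, hw, one_mul]

/-- `(τ₀ u)_{γ₁,γ₂} = u_{γ₁ - 1, γ₂}`. -/
def tau0 : EllTwo →L[ℂ] EllTwo :=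
  (phaseShift (fun _ => 1) (fun _ => norm_one) (1, 0)).toContinuousLinearMap

/-- `(τ₁ u)_{γ₁,γ₂} = e^{-iΦγ₁} u_{γ₁, γ₂ - 1}`. -/
def tau1 (Φ : ℝ) : EllTwo →L[ℂ] EllTwo :=
  (phaseShift (fun γ => Complex.exp (((-(Φ * (γ.1 : ℝ)) : ℝ) : ℂ) * Complex.I))
    (fun _ => Complex.norm_exp_ofReal_mul_I _) (0, 1)).toContinuousLinearMap

/-- The operator `1 + τ₀ + τ₁`. -/
def hop (Φ : ℝ) : EllTwo →L[ℂ] EllTwo := 1 + tau0 + tau1 Φ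

/-- The Hilbert space direct sum `ℓ²(ℤ²; ℂ) ⊕ ℓ²(ℤ²; ℂ)`. -/
abbrev TwoEllTwo : Type := WithLp 2 (EllTwo × EllTwo)

/-- The tight-binding Hamiltonian
`Q_Λ(Φ) = (1/3) [[0, 1 + τ₀ + τ₁], [(1 + τ₀ + τ₁)^*, 0]]`. -/
def QLambda (Φ : ℝ) : TwoEllTwo →L[ℂ] TwoEllTwo :=
  (1 / 3 : ℂ) •
    ((WithLp.prodContinuousLinearEquiv 2 ℂ EllTwo EllTwo).symm.toContinuousLinearMap ∘L
      (((hop Φ) ∘L ContinuousLinearMap.snd ℂ EllTwo EllTwo).prod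
        ((ContinuousLinearMap.adjoint (hop Φ)) ∘L ContinuousLinearMap.fst ℂ EllTwo EllTwo)) ∘L
      (WithLp.prodContinuousLinearEquiv 2 ℂ EllTwo EllTwo).toContinuousLinearMap)

/-- `Φ / 2π` is irrational, and `q_n ^ 4 * |Φ / 2π - p_n / q_n| < C` along some sequence of
reduced rationals `p_n / q_n` with `q_n → ∞`. -/
def IsGenericFlux (Φ : ℝ) : Prop :=
  Irrational (Φ / (2 * Real.pi)) ∧
    ∃ (C : ℝ) (r : ℕ → ℚ), Tendsto (fun n => (r n).den) atTop atTop ∧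
      ∀ n, ((r n).den : ℝ) ^ 4 * |Φ / (2 * Real.pi) - (r n : ℝ)| < C

end HexQ

end

/-!
The spectrum of `Q_Λ(Φ)` at irrational flux is approximated by the spectra at nearby rational
fluxes, which are thin. All covers are made for `{(3 λ)² : λ ∈ σ(Q_Λ(Φ))}`, essentially the
spectrum of `T T*` with `T = 1 + τ₀ + τ₁`; the square root is locally Lipschitz away from `0`, so
this does not change the Hausdorff dimension.

*Rational flux.* At `Φ = 2π p / q` the operator `T` is a `q × q` matrix `1 + x S + y D` over the
commuting translations `x`, `y`, where `S` is the cyclic shift and `D` the clock matrix. The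
Chambers formula (`chambers`) says that `det (t - T T*)` depends on `x`, `y` only through
`(-1)^q ((1 + u + v)(1 + u⁻¹ + v⁻¹) - 1)`, where `u`, `v` are `x^q`, `y^q` times constants of
modulus one; this is `2` plus six unitaries, up to sign, of norm at most `8`. The remaining term is
`det (t - J)` for the fixed matrix `J = decoupled` obtained at a quasimomentum where a hopping
amplitude of the periodic Jacobi matrix `T T*` vanishes. Cramer's rule over the commutative algebra
of Laurent polynomials then confines the spectrum to `|det (t - J)| ≤ 8`
(`norm_det_decoupled_le_of_mem_spectrum`); no Fourier transform is needed.

*Thinness.* The corner entry of the resolvent of the Jacobi matrix `J` is the product of the hopping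
amplitudes, of modulus `∏ |1 - ζ^i| = q`, divided by `det (t - J)`. By the spectral theorem and
Cauchy–Schwarz, `1 / det (t - J) = ∑ a_i / (t - l_i)` with `∑ |a_i| ≤ 1 / q`
(`exists_partial_fractions`). Boole's lemma on sums of simple poles (`boole_cover`) covers the set
where this sum is at least `1 / 8` in modulus by `O(q)` intervals of total length `O(1 / q)`.

*Continuity.* The spectrum is Hölder-`1/2` continuous in the flux (`exists_mem_spectrum_near`):
cutting an approximate eigenvector to a window of width `|Φ - Φ'|^(-1/2)` and gauging the window
costs `O(|Φ - Φ'|^(1/2))`.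

For a generic flux `|Φ - 2π p / q| = O(q^(-4))`, so the enlarged intervals still have total length
`O(1 / q)`, and Cauchy–Schwarz bounds the sum of the square roots of their lengths. Genericity is
residual because Liouville numbers are.
-/

namespace HexQ

/-! ### Generic fluxes are residual -/

/-- A Liouville number has, for every exponent, rational approximations of that quality whose
reduced denominators tend to infinity. -/
theorem exists_seq_rat_of_liouville {x : ℝ} (hx : Liouville x) :
    ∃ r : ℕ → ℚ, Tendsto (fun n => (r n).den) atTop atTop ∧
      ∀ n, ((r n).den : ℝ) ^ 4 * |x - (r n : ℝ)| < 1 := by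
  have key : ∀ n : ℕ, ∃ r : ℚ, (r.den : ℝ) ^ 4 * |x - (r : ℝ)| < 1 ∧
      |x - (r : ℝ)| < 1 / 2 ^ n := by
    intro n
    obtain ⟨a, b, hb, -, hab⟩ := hx (n + 4)
    have hb0 : (0 : ℝ) < b := by exact_mod_cast (by omega : 0 < b)
    have hb2 : (2 : ℝ) ≤ b := by exact_mod_cast (by omega : 2 ≤ b)
    have hr : (((a : ℚ) / (b : ℚ) : ℚ) : ℝ) = a / b := by push_cast; rfl
    refine ⟨(a : ℚ) / b, ?_, ?_⟩
    · rw [hr]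
      have hden : ((((a : ℚ) / (b : ℚ)).den : ℤ)) ≤ b :=
        Int.le_of_dvd (by omega) (by rw [← Rat.divInt_eq_div]; exact Rat.den_dvd a b)
      have hden' : ((((a : ℚ) / (b : ℚ)).den : ℝ)) ≤ b := by exact_mod_cast hden
      calc _ ≤ (b : ℝ) ^ 4 * |x - a / b| := by gcongr
        _ < (b : ℝ) ^ 4 * (1 / b ^ (n + 4)) := by gcongr
        _ = 1 / b ^ n := by rw [pow_add]; field_simp
        _ ≤ 1 := by
          rw [div_le_one (by positivity)]
          exact one_le_pow₀ (by linarith)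
    · rw [hr]
      refine hab.trans_le ?_
      gcongr
      calc (2 : ℝ) ^ n ≤ b ^ n := by gcongr
        _ ≤ b ^ (n + 4) := pow_le_pow_right₀ (by linarith) (by omega)
  choose r hr1 hr2 using key
  refine ⟨r, ?_, hr1⟩
  have hlim : Tendsto (fun n => (r n : ℝ)) atTop (𝓝 x) := by
    rw [tendsto_iff_dist_tendsto_zero]
    refine squeeze_zero (fun _ => dist_nonneg) (fun n => ?_)
      (tendsto_pow_atTop_nhds_zero_of_lt_one (r := (1 / 2 : ℝ)) (by norm_num) (by norm_num))
    rw [dist_comm, Real.dist_eq, one_div_pow]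
    exact (hr2 n).le
  have := (hx.irrational).eventually_forall_le_dist_cast_rat_of_den_le
  refine tendsto_atTop.2 fun N => ?_
  obtain ⟨ε, hε0, hε⟩ : ∃ ε > 0, ∀ r : ℚ, r.den ≤ N → ε ≤ dist x r := by
    have h := this N
    obtain ⟨ε, h1, h2⟩ := (h.filter_mono nhdsWithin_le_nhds |>.and
      (self_mem_nhdsWithin : Set.Ioi (0 : ℝ) ∈ 𝓝[>] 0)).exists
    exact ⟨ε, h2, h1⟩
  filter_upwards [Metric.tendsto_nhds.1 hlim ε hε0] with n hn
  by_contra! hlt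
  have := hε (r n) hlt.le
  rw [dist_comm] at hn
  linarith

theorem eventually_residual_isGenericFlux : ∀ᶠ Φ : ℝ in residual ℝ, IsGenericFlux Φ := by
  have h2 : (2 * Real.pi) ≠ 0 := by positivity
  rw [← (Homeomorph.mulRight₀ (2 * Real.pi) h2).residual_map_eq, eventually_map]
  filter_upwards [eventually_residual_liouville] with x hx
  have e : (Homeomorph.mulRight₀ (2 * Real.pi) h2) x / (2 * Real.pi) = x := by
    simp only [Homeomorph.coe_mulRight₀]
    field_simp
  obtain ⟨r, hr, hr'⟩ := exists_seq_rat_of_liouville hx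
  refine ⟨by rw [e]; exact hx.irrational, 1, r, hr, fun n => by rw [e]; exact hr' n⟩

/-! ### Superlevel sets of sums of simple poles -/

open Polynomial in
/-- The polynomial identity behind Boole's lemma: the solutions `ξ l` of
`∑ a l / (x - l) = t`, one to the right of each pole, are the zeros of the numerator of
`1 - t⁻¹ ∑ a l / (x - l)`. -/
theorem prod_X_sub_C_eq_of_simple_poles (s : Finset ℝ) (a ξ : ℝ → ℝ) {t : ℝ} (ht : t ≠ 0)
    (hξ : Set.InjOn ξ s) (hns : ∀ l ∈ s, ξ l ∉ s)
    (hsol : ∀ l ∈ s, ∑ m ∈ s, a m / (ξ l - m) = t) :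
    ∏ l ∈ s, (X - C (ξ l)) = ∏ l ∈ s, (X - C l) -
      ∑ m ∈ s, C (a m / t) * ∏ l ∈ s.erase m, (X - C l) := by
  classical
  rcases s.eq_empty_or_nonempty with rfl | hne
  · simp
  set P := ∏ l ∈ s, (X - C (ξ l)) with hP
  set L := ∏ l ∈ s, (X - C l) with hL
  set S := ∑ m ∈ s, C (a m / t) * ∏ l ∈ s.erase m, (X - C l) with hS
  have hdP : P.degree = s.card := by
    rw [hP, degree_prod]; simp
  have hdL : L.degree = s.card := by
    rw [hL, degree_prod]; simp
  have hdS : S.degree < s.card := by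
    refine (degree_sum_le _ _).trans_lt ((Finset.sup_lt_iff (WithBot.bot_lt_coe _)).2 ?_)
    intro m hm
    rw [← smul_eq_C_mul]
    refine (degree_smul_le _ _).trans_lt ?_
    rw [degree_prod]
    simp only [degree_X_sub_C, Finset.sum_const, nsmul_eq_mul, mul_one]
    exact_mod_cast Finset.card_erase_lt_of_mem hm
  have hmP : P.Monic := monic_prod_of_monic _ _ fun _ _ => monic_X_sub_C _
  have hmL : L.Monic := monic_prod_of_monic _ _ fun _ _ => monic_X_sub_C _
  have hd : (P - L + S).degree < s.card := by
    refine (degree_add_le _ _).trans_lt (max_lt ?_ hdS)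
    rw [← hdP]
    exact degree_sub_lt_left (hdP.trans hdL.symm) hmP.ne_zero (by
      rw [hmP.leadingCoeff, hmL.leadingCoeff])
  have h0 : P - L + S = 0 := by
    refine eq_zero_of_degree_lt_of_eval_finset_eq_zero (s.image ξ)
      (by rwa [Finset.card_image_of_injOn hξ]) ?_
    intro y hy
    obtain ⟨l, hl, rfl⟩ := Finset.mem_image.1 hy
    have hne : ∀ m ∈ s, ξ l - m ≠ 0 := fun m hm h => hns l hl (sub_eq_zero.1 h ▸ hm)
    have e1 : P.eval (ξ l) = 0 := by
      rw [hP, eval_prod]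
      exact Finset.prod_eq_zero hl (by simp)
    have e2 : S.eval (ξ l) = L.eval (ξ l) := by
      rw [hS, hL, eval_finsetSum, eval_prod]
      simp only [eval_mul, eval_C, eval_prod, eval_sub, eval_X]
      calc _ = ∑ m ∈ s, (a m / (ξ l - m)) / t * ∏ i ∈ s, (ξ l - i) := by
            refine Finset.sum_congr rfl fun m hm => ?_
            rw [← Finset.mul_prod_erase s _ hm]
            have := hne m hm
            field_simp
        _ = _ := by
            rw [← Finset.sum_mul, ← Finset.sum_div, hsol l hl, div_self ht, one_mul]
    rw [eval_add, eval_sub, e1, e2]; ring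
  linear_combination h0

/-- Between a pole and the next one to the right (or `∞`), a sum of simple poles with positive
masses takes every positive value. -/
theorem exists_simple_poles_eq (s : Finset ℝ) (a : ℝ → ℝ) (ha : ∀ l ∈ s, 0 < a l) {t : ℝ}
    (ht : 0 < t) {l : ℝ} (hl : l ∈ s) :
    ∃ x, l < x ∧ (∀ m ∈ s, l < m → x < m) ∧ ∑ m ∈ s, a m / (x - m) = t := by
  classical
  set I : Set ℝ := {x | l < x ∧ ∀ m ∈ s, l < m → x < m} with hI
  have hIc : IsPreconnected I := by
    refine Set.OrdConnected.isPreconnected ⟨fun x hx y hy z hz => ?_⟩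
    exact ⟨hx.1.trans_le hz.1, fun m hm hlm => hz.2.trans_lt (hy.2 m hm hlm)⟩
  have hcont : ContinuousOn (fun x => ∑ m ∈ s, a m / (x - m)) I := by
    refine continuousOn_finsetSum _ fun m hm => ?_
    refine continuousOn_const.div (continuousOn_id.sub continuousOn_const) fun x hx h => ?_
    have hxm : x = m := sub_eq_zero.1 h
    exact lt_irrefl _ (hxm ▸ hx.2 m hm (hxm ▸ hx.1))
  have hev : ∀ᶠ x in 𝓝[>] l, x ∈ I := by
    have h1 : ∀ᶠ x in 𝓝 l, ∀ m ∈ s, l < m → x < m := by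
      rw [Filter.eventually_all_finset]
      intro m _
      by_cases h : l < m
      · filter_upwards [eventually_lt_nhds h] with x hx _ using hx
      · exact Eventually.of_forall fun x hx => absurd hx h
    filter_upwards [h1.filter_mono nhdsWithin_le_nhds, self_mem_nhdsWithin] with x hx hx'
    exact ⟨hx', hx⟩
  have hrest : ∀ b, Tendsto (fun x => ∑ m ∈ s.erase b, a m / (x - m)) (𝓝 b)
      (𝓝 (∑ m ∈ s.erase b, a m / (b - m))) := by
    intro b
    refine tendsto_finsetSum _ fun m hm => ?_
    exact tendsto_const_nhds.div (tendsto_id.sub tendsto_const_nhds)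
      (sub_ne_zero.2 (Finset.ne_of_mem_erase hm).symm)
  have htop : Tendsto (fun x => ∑ m ∈ s, a m / (x - m)) (𝓝[>] l) atTop := by
    simp_rw [← Finset.add_sum_erase s _ hl]
    refine Tendsto.atTop_add ?_ ((hrest l).mono_left nhdsWithin_le_nhds)
    simp_rw [div_eq_mul_inv]
    refine Tendsto.const_mul_atTop (ha l hl) (tendsto_inv_nhdsGT_zero.comp ?_)
    refine tendsto_nhdsWithin_iff.2 ⟨?_, ?_⟩
    · have : Tendsto (fun x : ℝ => x - l) (𝓝 l) (𝓝 (l - l)) := tendsto_id.sub tendsto_const_nhds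
      rw [sub_self] at this
      exact this.mono_left nhdsWithin_le_nhds
    · filter_upwards [self_mem_nhdsWithin] with x hx using sub_pos.2 (Set.mem_Ioi.1 hx)
  by_cases hN : (s.filter (l < ·)).Nonempty
  · set b := (s.filter (l < ·)).min' hN with hb
    have hbm := Finset.min'_mem _ hN
    rw [← hb, Finset.mem_filter] at hbm
    have hbmin : ∀ m ∈ s, l < m → b ≤ m := fun m hm hlm =>
      Finset.min'_le _ _ (Finset.mem_filter.2 ⟨hm, hlm⟩)
    have hevb : ∀ᶠ x in 𝓝[<] b, x ∈ I := by
      filter_upwards [self_mem_nhdsWithin,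
        (eventually_gt_nhds hbm.2).filter_mono nhdsWithin_le_nhds] with x hx hx'
      exact ⟨hx', fun m hm hlm => lt_of_lt_of_le hx (hbmin m hm hlm)⟩
    have hbot : Tendsto (fun x => ∑ m ∈ s, a m / (x - m)) (𝓝[<] b) atBot := by
      simp_rw [← Finset.add_sum_erase s _ hbm.1]
      refine Tendsto.atBot_add ?_ ((hrest b).mono_left nhdsWithin_le_nhds)
      simp_rw [div_eq_mul_inv]
      refine Tendsto.const_mul_atBot (ha b hbm.1) (tendsto_inv_nhdsLT_zero.comp ?_)
      refine tendsto_nhdsWithin_iff.2 ⟨?_, ?_⟩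
      · have : Tendsto (fun x : ℝ => x - b) (𝓝 b) (𝓝 (b - b)) :=
          tendsto_id.sub tendsto_const_nhds
        rw [sub_self] at this
        exact this.mono_left nhdsWithin_le_nhds
      · filter_upwards [self_mem_nhdsWithin] with x hx using sub_neg.2 (Set.mem_Iio.1 hx)
    obtain ⟨x, hx, hxt⟩ := hIc.intermediate_value_Iii (le_principal_iff.2 hevb)
      (le_principal_iff.2 hev) hcont hbot htop (Set.mem_univ t)
    exact ⟨x, hx.1, hx.2, hxt⟩
  · have hnone : ∀ m ∈ s, ¬ l < m := fun m hm hlm =>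
      hN ⟨m, Finset.mem_filter.2 ⟨hm, hlm⟩⟩
    have hevt : ∀ᶠ x in atTop, x ∈ I := by
      filter_upwards [eventually_gt_atTop l] with x hx
      exact ⟨hx, fun m hm hlm => absurd hlm (hnone m hm)⟩
    have hzero : Tendsto (fun x => ∑ m ∈ s, a m / (x - m)) atTop (𝓝 0) := by
      have : Tendsto (fun x => ∑ m ∈ s, a m / (x - m)) atTop (𝓝 (∑ m ∈ s, 0)) :=
        tendsto_finsetSum _ fun m _ => tendsto_const_nhds.div_atTop
          (tendsto_atTop_add_const_right _ (-m) tendsto_id)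
      simpa using this
    obtain ⟨x, hx, hxt⟩ := hIc.intermediate_value_Ioi (le_principal_iff.2 hevt)
      (le_principal_iff.2 hev) hcont hzero htop (Set.mem_Ioi.2 ht)
    exact ⟨x, hx.1, hx.2, hxt⟩

/-- Boole's lemma in covering form: the set where a sum of `n` simple poles with positive masses
`a l` is at least `t > 0` is covered by `n` intervals of total length `t⁻¹ ∑ a l`. -/
theorem boole_cover (s : Finset ℝ) (a : ℝ → ℝ) (ha : ∀ l ∈ s, 0 < a l) {t : ℝ} (ht : 0 < t) :
    ∃ ξ : ℝ → ℝ, (∀ l ∈ s, l ≤ ξ l) ∧ ∑ l ∈ s, (ξ l - l) = (∑ l ∈ s, a l) / t ∧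
      ∀ x, t ≤ ∑ l ∈ s, a l / (x - l) → ∃ l ∈ s, x ∈ Set.Icc l (ξ l) := by
  classical
  have hex : ∀ l, ∃ x, l ∈ s →
      l < x ∧ (∀ m ∈ s, l < m → x < m) ∧ ∑ m ∈ s, a m / (x - m) = t := by
    intro l
    by_cases hl : l ∈ s
    · obtain ⟨x, hx⟩ := exists_simple_poles_eq s a ha ht hl
      exact ⟨x, fun _ => hx⟩
    · exact ⟨0, fun h => absurd h hl⟩
  choose ξ hξ using hex
  have hns : ∀ l ∈ s, ξ l ∉ s := fun l hl h =>
    lt_irrefl _ ((hξ l hl).2.1 _ h (hξ l hl).1)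
  have hinj : Set.InjOn ξ s := by
    intro l hl m hm h
    rcases lt_trichotomy l m with hlt | heq | hlt
    · have h1 := (hξ l hl).2.1 m hm hlt
      have h2 := (hξ m hm).1
      linarith
    · exact heq
    · have h1 := (hξ m hm).2.1 l hl hlt
      have h2 := (hξ l hl).1
      linarith
  have hpoly := prod_X_sub_C_eq_of_simple_poles s a ξ ht.ne' hinj hns fun l hl => (hξ l hl).2.2
  refine ⟨ξ, fun l hl => (hξ l hl).1.le, ?_, ?_⟩
  · rcases s.eq_empty_or_nonempty with rfl | hne
    · simp
    have hc := congrArg (fun p => Polynomial.coeff p (s.card - 1)) hpoly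
    have hcard := hne.card_pos
    simp only [Polynomial.coeff_sub, Polynomial.finsetSum_coeff, Polynomial.coeff_C_mul] at hc
    rw [Polynomial.prod_X_sub_C_coeff_card_pred s _ hcard,
      Polynomial.prod_X_sub_C_coeff_card_pred s _ hcard] at hc
    have h1 : ∀ m ∈ s, (∏ l ∈ s.erase m, (Polynomial.X - Polynomial.C l)).coeff (s.card - 1)
        = 1 := by
      intro m hm
      have hmon : (∏ l ∈ s.erase m, (Polynomial.X - Polynomial.C l)).Monic :=
        Polynomial.monic_prod_of_monic _ _ fun _ _ => Polynomial.monic_X_sub_C _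
      have hdeg : (∏ l ∈ s.erase m, (Polynomial.X - Polynomial.C l)).natDegree = s.card - 1 := by
        rw [Polynomial.natDegree_prod_of_monic _ _ fun _ _ => Polynomial.monic_X_sub_C _]
        simp [Finset.card_erase_of_mem hm]
      rw [← hdeg]
      exact hmon.coeff_natDegree
    have h2 : ∑ m ∈ s, a m / t * (∏ l ∈ s.erase m, (Polynomial.X - Polynomial.C l)).coeff
        (s.card - 1) = (∑ m ∈ s, a m) / t := by
      rw [Finset.sum_div]
      exact Finset.sum_congr rfl fun m hm => by rw [h1 m hm, mul_one]
    rw [h2] at hc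
    rw [Finset.sum_sub_distrib]
    linarith
  · intro x hF
    by_cases hx : x ∈ s
    · exact ⟨x, hx, le_rfl, (hξ x hx).1.le⟩
    by_contra! hcon
    have hne : ∀ m ∈ s, x - m ≠ 0 := fun m hm h => hx (sub_eq_zero.1 h ▸ hm)
    have hev := congrArg (Polynomial.eval x) hpoly
    simp only [Polynomial.eval_prod, Polynomial.eval_sub, Polynomial.eval_X, Polynomial.eval_C,
      Polynomial.eval_finsetSum, Polynomial.eval_mul] at hev
    have e : ∏ l ∈ s, (x - ξ l) / (x - l) = 1 - (∑ m ∈ s, a m / (x - m)) / t := by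
      rw [Finset.prod_div_distrib, div_eq_iff (Finset.prod_ne_zero_iff.2 hne), hev, sub_mul,
        one_mul, Finset.sum_div, Finset.sum_mul]
      congr 1
      refine Finset.sum_congr rfl fun m hm => ?_
      rw [← Finset.mul_prod_erase s _ hm]
      have := hne m hm
      field_simp
    have hpos : 0 < ∏ l ∈ s, (x - ξ l) / (x - l) := by
      refine Finset.prod_pos fun l hl => ?_
      have h1 := hcon l hl
      have h2 := (hξ l hl).1
      rcases lt_or_gt_of_ne (sub_ne_zero.1 (hne l hl)) with h3 | h3
      · exact div_pos_of_neg_of_neg (by linarith) (by linarith)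
      · refine div_pos ?_ (by linarith)
        by_contra! h4
        exact h1 ⟨h3.le, by linarith⟩
    rw [e] at hpos
    have : 1 ≤ (∑ m ∈ s, a m / (x - m)) / t := (one_le_div ht).2 hF
    linarith

/-- `S` is covered by at most `n` compact intervals of total length at most `L`. -/
def IntervalCover (n : ℕ) (L : ℝ) (S : Set ℝ) : Prop :=
  ∃ k ≤ n, ∃ c d : Fin k → ℝ, (∀ i, c i ≤ d i) ∧ ∑ i, (d i - c i) ≤ L ∧
    S ⊆ ⋃ i, Set.Icc (c i) (d i)

theorem IntervalCover.mono {n m : ℕ} {L M : ℝ} {S T : Set ℝ} (h : IntervalCover n L S)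
    (hn : n ≤ m) (hL : L ≤ M) (hS : T ⊆ S) : IntervalCover m M T := by
  obtain ⟨k, hk, c, d, h1, h2, h3⟩ := h
  exact ⟨k, hk.trans hn, c, d, h1, h2.trans hL, hS.trans h3⟩

theorem IntervalCover.union {n m : ℕ} {L M : ℝ} {S T : Set ℝ} (h : IntervalCover n L S)
    (h' : IntervalCover m M T) : IntervalCover (n + m) (L + M) (S ∪ T) := by
  obtain ⟨k, hk, c, d, h1, h2, h3⟩ := h
  obtain ⟨k', hk', c', d', h1', h2', h3'⟩ := h'
  refine ⟨k + k', add_le_add hk hk', Fin.append c c', Fin.append d d', ?_, ?_, ?_⟩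
  · intro i
    refine Fin.addCases (fun i => ?_) (fun i => ?_) i
    · simpa using h1 i
    · simpa using h1' i
  · rw [Fin.sum_univ_add]
    simpa using add_le_add h2 h2'
  · rintro x (hx | hx)
    · obtain ⟨i, hi⟩ := Set.mem_iUnion.1 (h3 hx)
      exact Set.mem_iUnion.2 ⟨Fin.castAdd k' i, by simpa using hi⟩
    · obtain ⟨i, hi⟩ := Set.mem_iUnion.1 (h3' hx)
      exact Set.mem_iUnion.2 ⟨Fin.natAdd k i, by simpa using hi⟩

theorem IntervalCover.of_finset {s : Finset ℝ} {c d : ℝ → ℝ} {S : Set ℝ}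
    (h : ∀ l ∈ s, c l ≤ d l) (hS : ∀ x ∈ S, ∃ l ∈ s, x ∈ Set.Icc (c l) (d l)) :
    IntervalCover s.card (∑ l ∈ s, (d l - c l)) S := by
  refine ⟨s.card, le_rfl, fun i => c (s.equivFin.symm i), fun i => d (s.equivFin.symm i),
    fun i => h _ (s.equivFin.symm i).2, le_of_eq ?_, fun x hx => ?_⟩
  · rw [← Finset.sum_coe_sort s (fun l => d l - c l)]
    exact s.equivFin.symm.sum_comp (fun l : s => d l - c l)
  · obtain ⟨l, hl, hxl⟩ := hS x hx
    exact Set.mem_iUnion.2 ⟨s.equivFin ⟨l, hl⟩, by simpa using hxl⟩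

/-- Two-sided form of `boole_cover`: the part where the sum is very negative is handled by
reflecting the line. -/
theorem intervalCover_abs_simple_poles (s : Finset ℝ) (a : ℝ → ℝ) (ha : ∀ l ∈ s, 0 < a l) {t : ℝ}
    (ht : 0 < t) : IntervalCover (s.card + s.card) ((∑ l ∈ s, a l) / t + (∑ l ∈ s, a l) / t)
      {x | t ≤ |∑ l ∈ s, a l / (x - l)|} := by
  classical
  obtain ⟨ξ, h1, h2, h3⟩ := boole_cover s a ha ht
  obtain ⟨η, h1', h2', h3'⟩ := boole_cover (s.image Neg.neg) (fun l => a (-l))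
    (fun l hl => by
      obtain ⟨m, hm, rfl⟩ := Finset.mem_image.1 hl
      simpa using ha m hm) ht
  rw [Finset.sum_image neg_injective.injOn, Finset.sum_image neg_injective.injOn] at h2'
  simp only [neg_neg] at h2'
  have c1 : IntervalCover s.card ((∑ l ∈ s, a l) / t) {x | t ≤ ∑ l ∈ s, a l / (x - l)} :=
    h2 ▸ IntervalCover.of_finset h1 h3
  have c2 : IntervalCover s.card ((∑ l ∈ s, a l) / t) {x | t ≤ -∑ l ∈ s, a l / (x - l)} := by
    have h4 : ∑ l ∈ s, (l - -η (-l)) = (∑ l ∈ s, a l) / t := by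
      rw [← h2']
      exact Finset.sum_congr rfl fun l _ => by ring
    rw [← h4]
    refine IntervalCover.of_finset (fun l hl => ?_) fun x hx => ?_
    · have := h1' (-l) (Finset.mem_image_of_mem _ hl)
      linarith
    · obtain ⟨l, hl, hl'⟩ := h3' (-x) (by
        rw [Finset.sum_image neg_injective.injOn]
        simp only [neg_neg]
        refine le_of_le_of_eq hx ?_
        rw [← Finset.sum_neg_distrib]
        refine Finset.sum_congr rfl fun m _ => ?_
        rw [← div_neg]
        congr 1
        ring)
      obtain ⟨m, hm, rfl⟩ := Finset.mem_image.1 hl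
      exact ⟨m, hm, by linarith [hl'.2], by linarith [hl'.1]⟩
  refine (c1.union c2).mono le_rfl le_rfl fun x hx => ?_
  rcases le_abs.1 (show t ≤ |∑ l ∈ s, a l / (x - l)| from hx) with h | h
  · exact Or.inl h
  · exact Or.inr h

/-- The weak-type bound for finite Hilbert transforms, in covering form and with signed masses. -/
theorem intervalCover_abs_signed_simple_poles {ι : Type*} [Fintype ι] (l a : ι → ℝ) {t : ℝ}
    (ht : 0 < t) : IntervalCover (3 * Fintype.card ι) (4 * (∑ i, |a i|) / t)
      {x | (∃ i, x = l i) ∨ t ≤ |∑ i, a i / (x - l i)|} := by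
  classical
  set s : Finset ℝ := Finset.univ.image l with hs
  -- Equal poles are merged, and the merged masses are split according to their sign.
  set A : ℝ → ℝ := fun m => ∑ i with l i = m, a i with hA
  set sp := s.filter (fun m => 0 < A m)
  set sn := s.filter (fun m => ¬ 0 < A m ∧ A m < 0)
  have hsum : ∀ x, ∑ i, a i / (x - l i) =
      ∑ m ∈ sp, A m / (x - m) - ∑ m ∈ sn, (-A m) / (x - m) := by
    intro x
    have e1 : ∑ i, a i / (x - l i) = ∑ m ∈ s, A m / (x - m) := by
      rw [← Finset.sum_fiberwise_of_maps_to (g := l) (t := s)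
        fun i _ => Finset.mem_image_of_mem l (Finset.mem_univ i)]
      refine Finset.sum_congr rfl fun m _ => ?_
      rw [hA, Finset.sum_div]
      exact Finset.sum_congr rfl fun i hi => by rw [(Finset.mem_filter.1 hi).2]
    rw [e1, ← Finset.sum_filter_add_sum_filter_not s (fun m => 0 < A m), sub_eq_add_neg,
      ← Finset.sum_neg_distrib]
    congr 1
    rw [← Finset.sum_filter_add_sum_filter_not (s.filter fun m => ¬ 0 < A m) (fun m => A m < 0)]
    rw [Finset.filter_filter, Finset.filter_filter]
    have e2 : ∑ m ∈ s.filter (fun m => ¬ 0 < A m ∧ ¬ A m < 0), A m / (x - m) = 0 := by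
      refine Finset.sum_eq_zero fun m hm => ?_
      obtain ⟨-, h1, h2⟩ := Finset.mem_filter.1 hm
      rw [le_antisymm (not_lt.1 h1) (not_lt.1 h2), zero_div]
    rw [e2, add_zero]
    exact Finset.sum_congr rfl fun m _ => by rw [neg_div, neg_neg]
  have habs : ∑ m ∈ sp, A m + ∑ m ∈ sn, (-A m) ≤ ∑ i, |a i| := by
    have e1 : ∑ m ∈ sp, A m + ∑ m ∈ sn, (-A m) ≤ ∑ m ∈ s, |A m| := by
      rw [← Finset.sum_filter_add_sum_filter_not s (fun m => 0 < A m) (fun m => |A m|)]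
      refine add_le_add (Finset.sum_le_sum fun m _ => le_abs_self _) ?_
      refine (Finset.sum_le_sum fun m _ => neg_le_abs _).trans
        (Finset.sum_le_sum_of_subset_of_nonneg ?_ fun _ _ _ => abs_nonneg _)
      intro m hm
      obtain ⟨h0, h1, -⟩ := Finset.mem_filter.1 hm
      exact Finset.mem_filter.2 ⟨h0, h1⟩
    refine e1.trans ?_
    rw [← Finset.sum_fiberwise_of_maps_to (g := l) (t := s)
        fun i _ => Finset.mem_image_of_mem l (Finset.mem_univ i)]
    exact Finset.sum_le_sum fun m _ => Finset.abs_sum_le_sum_abs _ _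
  have hcard : sp.card + sn.card ≤ s.card := by
    rw [← Finset.card_filter_add_card_filter_not (s := s) (fun m => 0 < A m)]
    refine add_le_add le_rfl (Finset.card_le_card ?_)
    intro m hm
    obtain ⟨h0, h1, -⟩ := Finset.mem_filter.1 hm
    exact Finset.mem_filter.2 ⟨h0, h1⟩
  have hs' : s.card ≤ Fintype.card ι := Finset.card_image_le
  have c0 : IntervalCover s.card (∑ m ∈ s, (m - m)) {x | ∃ i, x = l i} := by
    refine IntervalCover.of_finset (c := id) (d := id) (fun _ _ => le_rfl) ?_
    rintro x ⟨i, rfl⟩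
    exact ⟨l i, Finset.mem_image_of_mem l (Finset.mem_univ i), le_rfl, le_rfl⟩
  have c1 := intervalCover_abs_simple_poles sp A (fun m hm => (Finset.mem_filter.1 hm).2)
    (half_pos ht)
  have c2 := intervalCover_abs_simple_poles sn (fun m => -A m)
    (fun m hm => neg_pos.2 (Finset.mem_filter.1 hm).2.2) (half_pos ht)
  refine (c0.union (c1.union c2)).mono (by omega) ?_ ?_
  · simp only [sub_self, Finset.sum_const_zero, zero_add]
    rw [← add_div, ← add_div, ← add_div, div_le_div_iff₀ (half_pos ht) ht]
    nlinarith
  · rintro x (hx | hx)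
    · exact Or.inl hx
    · refine Or.inr ?_
      rw [hsum] at hx
      by_contra! hcon
      rw [Set.mem_union, not_or, Set.mem_ofPred_eq, Set.mem_ofPred_eq] at hcon
      have h1 := not_le.1 hcon.1
      have h2 := not_le.1 hcon.2
      have := abs_sub (∑ m ∈ sp, A m / (x - m)) (∑ m ∈ sn, (-A m) / (x - m))
      linarith

/-! ### Approximate eigenvectors of self-adjoint operators -/

section SelfAdjoint

variable {H : Type*} [NormedAddCommGroup H] [InnerProductSpace ℂ H] [CompleteSpace H]

/-- A self-adjoint operator that is bounded below is invertible. -/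
theorem isUnit_of_isSelfAdjoint_of_bound {B : H →L[ℂ] H} (hB : IsSelfAdjoint B) {c : ℝ}
    (hc : 0 < c) (h : ∀ u, c * ‖u‖ ≤ ‖B u‖) : IsUnit B := by
  have hanti : AntilipschitzWith (Real.toNNReal c⁻¹) B := by
    refine ContinuousLinearMap.antilipschitz_of_bound B fun u => ?_
    rw [Real.coe_toNNReal _ (by positivity), ← div_eq_inv_mul, le_div_iff₀ hc, mul_comm]
    exact h u
  rw [ContinuousLinearMap.isUnit_iff_bijective,
    ContinuousLinearMap.bijective_iff_dense_range_and_antilipschitz]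
  refine ⟨?_, _, hanti⟩
  rw [Submodule.topologicalClosure_eq_top_iff, ContinuousLinearMap.orthogonal_range,
    hB.adjoint_eq, LinearMap.ker_eq_bot]
  exact hanti.injective

theorem exists_approx_eigenvector_of_mem_spectrum {B : H →L[ℂ] H} (hB : IsSelfAdjoint B) {l : ℝ}
    (hl : (l : ℂ) ∈ spectrum ℂ B) {ε : ℝ} (hε : 0 < ε) :
    ∃ u : H, ‖B u - (l : ℂ) • u‖ < ε * ‖u‖ := by
  by_contra! hcon
  refine hl ?_
  have hs : IsSelfAdjoint (algebraMap ℂ (H →L[ℂ] H) l - B) :=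
    (IsSelfAdjoint.algebraMap _ (by simp [isSelfAdjoint_iff])).sub hB
  refine isUnit_of_isSelfAdjoint_of_bound hs hε fun u => (hcon u).trans_eq ?_
  rw [norm_sub_rev]
  rfl

theorem exists_mem_spectrum_of_approx_eigenvector {B : H →L[ℂ] H} (hB : IsSelfAdjoint B) {l δ : ℝ}
    {u : H} (hu : u ≠ 0) (h : ‖B u - (l : ℂ) • u‖ ≤ δ * ‖u‖) :
    ∃ m : ℝ, (m : ℂ) ∈ spectrum ℂ B ∧ |l - m| ≤ δ := by
  have hu0 : 0 < ‖u‖ := norm_pos_iff.2 hu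
  have hδ : 0 ≤ δ := nonneg_of_mul_nonneg_left ((norm_nonneg _).trans h) hu0
  have : Nontrivial H := ⟨u, 0, hu⟩
  by_cases hmem : (l : ℂ) ∈ spectrum ℂ B
  · exact ⟨l, hmem, by simpa using hδ⟩
  have hs : IsSelfAdjoint (algebraMap ℂ (H →L[ℂ] H) l - B) :=
    (IsSelfAdjoint.algebraMap _ (by simp [isSelfAdjoint_iff])).sub hB
  obtain ⟨c, hc⟩ := spectrum.notMem_iff.1 hmem
  have hcs : IsSelfAdjoint (↑c⁻¹ : H →L[ℂ] H) := by
    have h1 : star c = c := Units.ext (by rw [Units.coe_star, hc, hs.star_eq])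
    rw [isSelfAdjoint_iff, ← Units.coe_star, star_inv, h1]
  obtain ⟨z, hz, hzn⟩ := spectrum.exists_nnnorm_eq_spectralRadius (↑c⁻¹ : H →L[ℂ] H)
  rw [hcs.spectralRadius_eq_nnnorm] at hzn
  have hzn' : ‖z‖ = ‖(↑c⁻¹ : H →L[ℂ] H)‖ := by
    have : ‖z‖₊ = ‖(↑c⁻¹ : H →L[ℂ] H)‖₊ := by exact_mod_cast hzn
    exact congrArg NNReal.toReal this
  have hz0 : z ≠ 0 := fun h0 => spectrum.zero_notMem ℂ (c⁻¹).isUnit (h0 ▸ hz)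
  have hz' : z⁻¹ ∈ spectrum ℂ (c : H →L[ℂ] H) := by
    have := (spectrum.inv_mem_iff (r := Units.mk0 z hz0) (a := c⁻¹)).1 hz
    simpa using this
  rw [hc] at hz'
  have hm : (l : ℂ) - z⁻¹ ∈ spectrum ℂ B := by
    rw [← spectrum.singleton_sub_eq] at hz'
    obtain ⟨a, ha, b, hb, hab⟩ := hz'
    rw [Set.mem_singleton_iff] at ha
    have : b = (l : ℂ) - z⁻¹ := by rw [← hab, ← ha]; simp
    rwa [← this]
  have hre := hB.mem_spectrum_eq_re hm
  refine ⟨((l : ℂ) - z⁻¹).re, hre ▸ hm, ?_⟩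
  have h1 : ‖((l : ℂ) - (((l : ℂ) - z⁻¹).re : ℂ))‖ = ‖z‖⁻¹ := by
    rw [← hre, sub_sub_cancel, norm_inv]
  have h2 : |l - ((l : ℂ) - z⁻¹).re| = ‖z‖⁻¹ := by
    rw [← h1, ← Complex.ofReal_sub, Complex.norm_real, Real.norm_eq_abs]
  have h3 : ‖u‖ ≤ ‖z‖ * (δ * ‖u‖) := by
    calc ‖u‖ = ‖(↑c⁻¹ * ↑c : H →L[ℂ] H) u‖ := by rw [Units.inv_mul]; rfl
      _ ≤ ‖(↑c⁻¹ : H →L[ℂ] H)‖ * ‖(c : H →L[ℂ] H) u‖ :=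
        (↑c⁻¹ : H →L[ℂ] H).le_opNorm ((c : H →L[ℂ] H) u)
      _ ≤ ‖z‖ * (δ * ‖u‖) := by
        rw [hzn', hc]
        gcongr
        rw [norm_sub_rev] at h
        exact h
  rw [h2, inv_le_iff_one_le_mul₀' (norm_pos_iff.2 hz0)]
  nlinarith

end SelfAdjoint

/-! ### The Hamiltonian in coordinates -/

theorem adjoint_phaseShift_apply (w : ℤ × ℤ → ℂ) (hw : ∀ γ, ‖w γ‖ = 1) (d : ℤ × ℤ) (u : EllTwo)
    (γ : ℤ × ℤ) : (ContinuousLinearMap.adjoint (phaseShift w hw d).toContinuousLinearMap u) γ =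
      (starRingEnd ℂ) (w (γ + d)) * u (γ + d) := by
  have hw' : ∀ γ, ‖(starRingEnd ℂ) (w (γ + d))‖ = 1 := fun γ => by rw [RCLike.norm_conj, hw]
  set B := phaseShift (fun γ => (starRingEnd ℂ) (w (γ + d))) hw' (-d) with hB
  have h1 : (phaseShift w hw d).toContinuousLinearMap (B u) = u := by
    ext γ
    change w γ * ((starRingEnd ℂ) (w (γ - d + d)) * u (γ - d - -d)) = u γ
    rw [sub_add_cancel, sub_neg_eq_add, sub_add_cancel, ← mul_assoc, Complex.mul_conj', hw]
    simp
  have h2 : ContinuousLinearMap.adjoint (phaseShift w hw d).toContinuousLinearMap u = B u := by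
    conv_lhs => rw [← h1]
    have h3 := (ContinuousLinearMap.norm_map_iff_adjoint_comp_self
      (phaseShift w hw d).toContinuousLinearMap).1 (phaseShift w hw d).norm_map
    exact DFunLike.congr_fun h3 (B u)
  rw [h2]
  change (starRingEnd ℂ) (w (γ + d)) * u (γ - -d) = _
  rw [sub_neg_eq_add]

theorem hop_apply (Φ : ℝ) (u : EllTwo) (γ : ℤ × ℤ) :
    hop Φ u γ = u γ + u (γ - (1, 0)) +
      Complex.exp (((-(Φ * (γ.1 : ℝ)) : ℝ) : ℂ) * Complex.I) * u (γ - (0, 1)) := by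
  change u γ + 1 * u (γ - (1, 0)) + _ = _
  rw [one_mul]
  rfl

theorem adjoint_hop_apply (Φ : ℝ) (u : EllTwo) (γ : ℤ × ℤ) :
    ContinuousLinearMap.adjoint (hop Φ) u γ = u γ + u (γ + (1, 0)) +
      Complex.exp (((Φ * (γ.1 : ℝ) : ℝ) : ℂ) * Complex.I) * u (γ + (0, 1)) := by
  have h : ContinuousLinearMap.adjoint (hop Φ) u = u + ContinuousLinearMap.adjoint tau0 u +
      ContinuousLinearMap.adjoint (tau1 Φ) u := by
    rw [hop, map_add, map_add, ContinuousLinearMap.one_def, ContinuousLinearMap.adjoint_id]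
    rfl
  rw [h]
  change u γ + (ContinuousLinearMap.adjoint tau0 u) γ +
    (ContinuousLinearMap.adjoint (tau1 Φ) u) γ = _
  rw [tau0, tau1, adjoint_phaseShift_apply, adjoint_phaseShift_apply, map_one, one_mul,
    ← Complex.exp_conj, map_mul, Complex.conj_ofReal, Complex.conj_I]
  congr 3
  push_cast
  simp

theorem QLambda_fst (Φ : ℝ) (w : TwoEllTwo) : (QLambda Φ w).fst = (1 / 3 : ℂ) • hop Φ w.snd := rfl

theorem QLambda_snd (Φ : ℝ) (w : TwoEllTwo) :
    (QLambda Φ w).snd = (1 / 3 : ℂ) • ContinuousLinearMap.adjoint (hop Φ) w.fst := rfl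

theorem isSelfAdjoint_QLambda (Φ : ℝ) : IsSelfAdjoint (QLambda Φ) := by
  rw [ContinuousLinearMap.isSelfAdjoint_iff_isSymmetric]
  intro x y
  rw [WithLp.prod_inner_apply, WithLp.prod_inner_apply]
  change inner ℂ (QLambda Φ x).fst y.fst + inner ℂ (QLambda Φ x).snd y.snd =
    inner ℂ x.fst (QLambda Φ y).fst + inner ℂ x.snd (QLambda Φ y).snd
  rw [QLambda_fst, QLambda_snd, QLambda_fst, QLambda_snd, inner_smul_left, inner_smul_left,
    inner_smul_right, inner_smul_right, ContinuousLinearMap.adjoint_inner_left,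
    ContinuousLinearMap.adjoint_inner_right]
  have : (starRingEnd ℂ) (1 / 3 : ℂ) = 1 / 3 := by rw [map_div₀, map_one, map_ofNat]
  rw [this, add_comm]

theorem norm_sq_QLambda_sub (Φ l : ℝ) (w : TwoEllTwo) :
    9 * ‖QLambda Φ w - (l : ℂ) • w‖ ^ 2 =
      ‖hop Φ w.snd - ((3 * l : ℝ) : ℂ) • w.fst‖ ^ 2 +
      ‖ContinuousLinearMap.adjoint (hop Φ) w.fst - ((3 * l : ℝ) : ℂ) • w.snd‖ ^ 2 := by
  have e1 : hop Φ w.snd - ((3 * l : ℝ) : ℂ) • w.fst =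
      (3 : ℂ) • (QLambda Φ w - (l : ℂ) • w).fst := by
    rw [WithLp.sub_fst, WithLp.smul_fst, QLambda_fst, smul_sub, smul_smul, smul_smul]
    norm_num
  have e2 : ContinuousLinearMap.adjoint (hop Φ) w.fst - ((3 * l : ℝ) : ℂ) • w.snd =
      (3 : ℂ) • (QLambda Φ w - (l : ℂ) • w).snd := by
    rw [WithLp.sub_snd, WithLp.smul_snd, QLambda_snd, smul_sub, smul_smul, smul_smul]
    norm_num
  rw [e1, e2, norm_smul, norm_smul, WithLp.prod_norm_sq_eq_of_L2]
  norm_num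
  ring

theorem exists_approx_pair_of_mem_spectrum {Φ l : ℝ} (hl : (l : ℂ) ∈ spectrum ℂ (QLambda Φ))
    {ε : ℝ} (hε : 0 < ε) : ∃ u v : EllTwo,
      ‖hop Φ v - ((3 * l : ℝ) : ℂ) • u‖ ^ 2 +
        ‖ContinuousLinearMap.adjoint (hop Φ) u - ((3 * l : ℝ) : ℂ) • v‖ ^ 2 <
      ε ^ 2 * (‖u‖ ^ 2 + ‖v‖ ^ 2) := by
  obtain ⟨w, hw⟩ := exists_approx_eigenvector_of_mem_spectrum (isSelfAdjoint_QLambda Φ) hl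
    (ε := ε / 3) (by positivity)
  refine ⟨w.fst, w.snd, ?_⟩
  rw [← norm_sq_QLambda_sub, ← WithLp.prod_norm_sq_eq_of_L2]
  have := pow_lt_pow_left₀ hw (norm_nonneg _) two_ne_zero
  calc _ < 9 * (ε / 3 * ‖w‖) ^ 2 := by linarith
    _ = _ := by ring

theorem exists_mem_spectrum_of_approx_pair {Φ s δ : ℝ} (hδ : 0 ≤ δ) {u v : EllTwo}
    (h : ‖hop Φ v - (s : ℂ) • u‖ ^ 2 +
        ‖ContinuousLinearMap.adjoint (hop Φ) u - (s : ℂ) • v‖ ^ 2 <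
      δ ^ 2 * (‖u‖ ^ 2 + ‖v‖ ^ 2)) :
    ∃ m : ℝ, (m : ℂ) ∈ spectrum ℂ (QLambda Φ) ∧ |s - 3 * m| ≤ δ := by
  set w : TwoEllTwo := WithLp.toLp 2 (u, v) with hw
  have h1 := norm_sq_QLambda_sub Φ (s / 3) w
  rw [mul_div_cancel₀ s (by norm_num : (3 : ℝ) ≠ 0)] at h1
  change _ = ‖hop Φ v - (s : ℂ) • u‖ ^ 2 +
        ‖ContinuousLinearMap.adjoint (hop Φ) u - (s : ℂ) • v‖ ^ 2 at h1
  have h2 : ‖w‖ ^ 2 = ‖u‖ ^ 2 + ‖v‖ ^ 2 := WithLp.prod_norm_sq_eq_of_L2 w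
  rw [← h1, ← h2] at h
  have hw0 : w ≠ 0 := by
    rintro h0
    rw [h0] at h
    simp at h
  obtain ⟨m, hm, hm'⟩ := exists_mem_spectrum_of_approx_eigenvector (isSelfAdjoint_QLambda Φ)
    (l := s / 3) (δ := δ / 3) hw0 (by
      refine le_of_sq_le_sq ?_ (by positivity)
      nlinarith)
  refine ⟨m, hm, ?_⟩
  have : s - 3 * m = 3 * (s / 3 - m) := by ring
  rw [this, abs_mul, abs_of_pos (by norm_num : (0 : ℝ) < 3)]
  linarith

/-! ### Hölder continuity of the spectrum in the flux -/

section Window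

open scoped ENNReal

theorem ofReal_norm_sq_eq_tsum (u : EllTwo) :
    ENNReal.ofReal (‖u‖ ^ 2) = ∑' γ, ENNReal.ofReal (‖u γ‖ ^ 2) := by
  have hs : Summable fun γ => ‖u γ‖ ^ 2 := by
    have := (memℓp_gen_iff (by norm_num)).1 (lp.memℓp u)
    simpa using this
  have h := lp.norm_rpow_eq_tsum (p := 2) (by norm_num) u
  simp only [ENNReal.toReal_ofNat, Real.rpow_ofNat] at h
  rw [h, ENNReal.ofReal_tsum_of_nonneg (fun _ => by positivity) hs]

/-- Multiplication by a function bounded by one. -/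
noncomputable def mulLeOne (w : ℤ × ℤ → ℂ) (hw : ∀ γ, ‖w γ‖ ≤ 1) (u : EllTwo) : EllTwo :=
  ⟨fun γ => w γ * u γ, by
    have hu := lp.memℓp u
    refine memℓp_gen ?_
    rw [memℓp_gen_iff (by norm_num)] at hu
    refine hu.of_nonneg_of_le (fun γ => by positivity) fun γ => ?_
    gcongr
    rw [norm_mul]
    exact mul_le_of_le_one_left (norm_nonneg _) (hw γ)⟩

/-- The tent function of width `2 M`. -/
noncomputable def tent (M : ℕ) (n : ℤ) : ℝ := max 0 (1 - |(n : ℝ)| / (2 * M))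

theorem tent_nonneg (M : ℕ) (n : ℤ) : 0 ≤ tent M n := le_max_left _ _

theorem tent_le_one (M : ℕ) (n : ℤ) : tent M n ≤ 1 :=
  max_le zero_le_one (sub_le_self _ (by positivity))

theorem tent_eq_zero {M : ℕ} (hM : 0 < M) {n : ℤ} (hn : 2 * (M : ℤ) ≤ |n|) : tent M n = 0 := by
  have hM' : (0 : ℝ) < M := by exact_mod_cast hM
  have h : (2 * (M : ℝ)) ≤ |(n : ℝ)| := by exact_mod_cast hn
  refine max_eq_left ?_
  rw [sub_nonpos, one_le_div (by positivity)]
  exact h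

theorem half_le_tent {M : ℕ} (hM : 0 < M) {n : ℤ} (hn : |n| ≤ M) : 1 / 2 ≤ tent M n := by
  have hM' : (0 : ℝ) < M := by exact_mod_cast hM
  have h : |(n : ℝ)| ≤ M := by exact_mod_cast hn
  refine le_max_of_le_right ?_
  have : |(n : ℝ)| / (2 * M) ≤ 1 / 2 := by
    rw [div_le_div_iff₀ (by positivity) (by norm_num)]
    linarith
  linarith

theorem abs_tent_sub_le {M : ℕ} (hM : 0 < M) (n k : ℤ) (h : |n - k| = 1) :
    |tent M n - tent M k| ≤ 1 / (2 * M) := by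
  have hM' : (0 : ℝ) < M := by exact_mod_cast hM
  have h' : |(n : ℝ) - k| = 1 := by exact_mod_cast h
  refine (abs_max_sub_max_le_max _ _ _ _).trans (max_le (by simp) ?_)
  have e : 1 - |(n : ℝ)| / (2 * M) - (1 - |(k : ℝ)| / (2 * M)) =
      (|(k : ℝ)| - |(n : ℝ)|) / (2 * M) := by ring
  rw [e, abs_div, abs_of_pos (by positivity : (0 : ℝ) < 2 * M)]
  gcongr
  rw [← h', abs_sub_comm (n : ℝ)]
  exact abs_abs_sub_abs_le_abs_sub _ _

/-- `∑ χ²` for the tent `χ`. -/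
noncomputable def tentMass (M : ℕ) : ℝ≥0∞ := ∑' n : ℤ, ENNReal.ofReal (tent M n ^ 2)

theorem tentMass_ne_top {M : ℕ} (hM : 0 < M) : tentMass M ≠ ∞ := by
  rw [tentMass, tsum_eq_sum (s := Finset.Ioo (-(2 * (M : ℤ))) (2 * M))]
  · exact ENNReal.sum_ne_top.2 fun _ _ => ENNReal.ofReal_ne_top
  · intro n hn
    rw [tent_eq_zero hM]
    · simp
    · by_contra! h
      exact hn (Finset.mem_Ioo.2 (abs_lt.1 h))

theorem le_tentMass {M : ℕ} (hM : 0 < M) : ENNReal.ofReal (M / 2) ≤ tentMass M := by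
  refine le_trans ?_ (ENNReal.sum_le_tsum (Finset.Icc (-(M : ℤ)) M))
  rw [← ENNReal.ofReal_sum_of_nonneg fun _ _ => sq_nonneg _]
  refine ENNReal.ofReal_le_ofReal ?_
  have h1 : ∑ n ∈ Finset.Icc (-(M : ℤ)) M, (1 / 4 : ℝ) ≤
      ∑ n ∈ Finset.Icc (-(M : ℤ)) M, tent M n ^ 2 := by
    refine Finset.sum_le_sum fun n hn => ?_
    have := half_le_tent hM (abs_le.2 (Finset.mem_Icc.1 hn))
    nlinarith
  refine le_trans ?_ h1
  rw [Finset.sum_const, Int.card_Icc, nsmul_eq_mul]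
  have : (((M : ℤ) + 1 - -(M : ℤ)).toNat : ℝ) = 2 * M + 1 := by
    have h2 : ((M : ℤ) + 1 - -(M : ℤ)).toNat = 2 * M + 1 := by omega
    rw [h2]
    push_cast
    ring
  rw [this]
  linarith

theorem tsum_tent_diff_le {M : ℕ} (hM : 0 < M) (e : ℤ) (he : |e| = 1) :
    ∑' n : ℤ, ENNReal.ofReal ((tent M (n + e) - tent M n) ^ 2) ≤
      ENNReal.ofReal (4 / M ^ 2) * tentMass M := by
  have hM' : (1 : ℝ) ≤ M := by exact_mod_cast hM
  have h1 : ∑' n : ℤ, ENNReal.ofReal ((tent M (n + e) - tent M n) ^ 2) ≤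
      ENNReal.ofReal (2 / M) := by
    rw [tsum_eq_sum (s := Finset.Icc (-(2 * (M : ℤ))) (2 * M))]
    · rw [← ENNReal.ofReal_sum_of_nonneg fun _ _ => sq_nonneg _]
      refine ENNReal.ofReal_le_ofReal ?_
      have h2 : ∑ n ∈ Finset.Icc (-(2 * (M : ℤ))) (2 * M), (tent M (n + e) - tent M n) ^ 2 ≤
          ∑ n ∈ Finset.Icc (-(2 * (M : ℤ))) (2 * M), (1 / (2 * M) : ℝ) ^ 2 := by
        refine Finset.sum_le_sum fun n _ => ?_
        rw [← sq_abs]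
        gcongr
        exact abs_tent_sub_le hM _ _ (by simpa using he)
      refine h2.trans ?_
      rw [Finset.sum_const, Int.card_Icc, nsmul_eq_mul]
      have : ((2 * (M : ℤ) + 1 - -(2 * (M : ℤ))).toNat : ℝ) = 4 * M + 1 := by
        have h2 : (2 * (M : ℤ) + 1 - -(2 * (M : ℤ))).toNat = 4 * M + 1 := by omega
        rw [h2]
        push_cast
        ring
      rw [this, one_div, inv_pow, ← div_eq_mul_inv, div_le_div_iff₀ (by positivity) (by positivity)]
      nlinarith
    · intro n hn
      have hn' : 2 * (M : ℤ) < |n| := by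
        by_contra! h
        exact hn (Finset.mem_Icc.2 (abs_le.1 h))
      have h3 : |n| ≤ |n + e| + 1 := by
        have := abs_sub (n + e) e
        rw [add_sub_cancel_right, he] at this
        exact this
      rw [tent_eq_zero hM hn'.le, tent_eq_zero hM (by omega)]
      simp
  refine h1.trans ?_
  calc ENNReal.ofReal (2 / M) = ENNReal.ofReal (4 / M ^ 2) * ENNReal.ofReal (M / 2) := by
        rw [← ENNReal.ofReal_mul (by positivity)]
        congr 1
        field_simp
        norm_num
    _ ≤ _ := by
        gcongr
        exact le_tentMass hM

theorem tsum_tent_mul_sq_le {M : ℕ} (hM : 0 < M) (ε : ℝ) :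
    ∑' n : ℤ, ENNReal.ofReal ((tent M n * (ε * n)) ^ 2) ≤
      ENNReal.ofReal (4 * ε ^ 2 * M ^ 2) * tentMass M := by
  rw [tentMass, ← ENNReal.tsum_mul_left]
  refine ENNReal.tsum_le_tsum fun n => ?_
  rw [← ENNReal.ofReal_mul (by positivity)]
  refine ENNReal.ofReal_le_ofReal ?_
  by_cases h : 2 * (M : ℤ) ≤ |n|
  · rw [tent_eq_zero hM h]; simp
  · have h1 : |(n : ℝ)| ≤ 2 * M := by exact_mod_cast (not_le.1 h).le
    have h2 : (n : ℝ) ^ 2 ≤ (2 * M) ^ 2 := sq_le_sq' (by linarith [(abs_le.1 h1).1]) (abs_le.1 h1).2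
    have h3 : 0 ≤ (tent M n * ε) ^ 2 := sq_nonneg _
    nlinarith [mul_le_mul_of_nonneg_left h2 h3]

/-- Summing a three-term pointwise estimate over all positions of the cutoff. -/
theorem tsum_norm_sq_le {M : ℕ} (hM : 0 < M) (ε : ℝ) (e : ℤ) (he : |e| = 1)
    (σ₁ σ₂ : (ℤ × ℤ) ≃ (ℤ × ℤ)) (r a b : EllTwo) (F : ℤ → EllTwo)
    (hF : ∀ k γ, ‖F k γ‖ ≤ tent M (γ.1 - k) * ‖r γ‖ +
      |tent M (γ.1 - k + e) - tent M (γ.1 - k)| * ‖a (σ₁ γ)‖ +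
      |tent M (γ.1 - k) * (ε * (γ.1 - k : ℤ))| * ‖b (σ₂ γ)‖) :
    ∑' k, ENNReal.ofReal (‖F k‖ ^ 2) ≤ 3 * tentMass M * (ENNReal.ofReal (‖r‖ ^ 2) +
      ENNReal.ofReal (4 / M ^ 2) * ENNReal.ofReal (‖a‖ ^ 2) +
      ENNReal.ofReal (4 * ε ^ 2 * M ^ 2) * ENNReal.ofReal (‖b‖ ^ 2)) := by
  have hpt : ∀ k γ, ENNReal.ofReal (‖F k γ‖ ^ 2) ≤
      3 * (ENNReal.ofReal (tent M (γ.1 - k) ^ 2) * ENNReal.ofReal (‖r γ‖ ^ 2) +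
        ENNReal.ofReal ((tent M (γ.1 - k + e) - tent M (γ.1 - k)) ^ 2) *
          ENNReal.ofReal (‖a (σ₁ γ)‖ ^ 2) +
        ENNReal.ofReal ((tent M (γ.1 - k) * (ε * (γ.1 - k : ℤ))) ^ 2) *
          ENNReal.ofReal (‖b (σ₂ γ)‖ ^ 2)) := by
    intro k γ
    have h3 : (3 : ℝ≥0∞) = ENNReal.ofReal 3 := by simp
    rw [← ENNReal.ofReal_mul (sq_nonneg _), ← ENNReal.ofReal_mul (sq_nonneg _),
      ← ENNReal.ofReal_mul (sq_nonneg _), ← ENNReal.ofReal_add (by positivity) (by positivity),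
      ← ENNReal.ofReal_add (by positivity) (by positivity), h3,
      ← ENNReal.ofReal_mul (by norm_num)]
    refine ENNReal.ofReal_le_ofReal ?_
    refine (pow_le_pow_left₀ (norm_nonneg _) (hF k γ) 2).trans ?_
    rw [← sq_abs (tent M (γ.1 - k + e) - tent M (γ.1 - k)),
      ← sq_abs (tent M (γ.1 - k) * (ε * (γ.1 - k : ℤ)))]
    set A := tent M (γ.1 - k) * ‖r γ‖
    set B := |tent M (γ.1 - k + e) - tent M (γ.1 - k)| * ‖a (σ₁ γ)‖
    set D := |tent M (γ.1 - k) * (ε * (γ.1 - k : ℤ))| * ‖b (σ₂ γ)‖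
    rw [← mul_pow, ← mul_pow, ← mul_pow]
    nlinarith [sq_nonneg (A - B), sq_nonneg (A - D), sq_nonneg (B - D)]
  have hshift : ∀ (f : ℤ → ℝ≥0∞) (n : ℤ), ∑' k, f (n - k) = ∑' k, f k := fun f n =>
    (Equiv.subLeft n).tsum_eq f
  have hN : ∀ (σ : (ℤ × ℤ) ≃ (ℤ × ℤ)) (u : EllTwo),
      ∑' γ, ENNReal.ofReal (‖u (σ γ)‖ ^ 2) = ENNReal.ofReal (‖u‖ ^ 2) := fun σ u => by
    rw [ofReal_norm_sq_eq_tsum]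
    exact σ.tsum_eq fun γ => ENNReal.ofReal (‖u γ‖ ^ 2)
  calc ∑' k, ENNReal.ofReal (‖F k‖ ^ 2) = ∑' γ, ∑' k, ENNReal.ofReal (‖F k γ‖ ^ 2) := by
        rw [ENNReal.tsum_comm]
        exact tsum_congr fun k => ofReal_norm_sq_eq_tsum _
    _ ≤ ∑' γ : ℤ × ℤ, 3 * (tentMass M * ENNReal.ofReal (‖r γ‖ ^ 2) +
        (ENNReal.ofReal (4 / M ^ 2) * tentMass M) * ENNReal.ofReal (‖a (σ₁ γ)‖ ^ 2) +
        (ENNReal.ofReal (4 * ε ^ 2 * M ^ 2) * tentMass M) * ENNReal.ofReal (‖b (σ₂ γ)‖ ^ 2)) := by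
        refine ENNReal.tsum_le_tsum fun γ => ?_
        refine (ENNReal.tsum_le_tsum fun k => hpt k γ).trans ?_
        rw [ENNReal.tsum_mul_left, ENNReal.tsum_add, ENNReal.tsum_add, ENNReal.tsum_mul_right,
          ENNReal.tsum_mul_right, ENNReal.tsum_mul_right,
          hshift (fun n => ENNReal.ofReal (tent M n ^ 2)),
          hshift (fun n => ENNReal.ofReal ((tent M (n + e) - tent M n) ^ 2)),
          hshift (fun n => ENNReal.ofReal ((tent M n * (ε * n)) ^ 2))]
        gcongr
        · exact le_rfl
        · exact tsum_tent_diff_le hM e he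
        · exact tsum_tent_mul_sq_le hM ε
    _ = _ := by
        rw [ENNReal.tsum_mul_left, ENNReal.tsum_add, ENNReal.tsum_add, ENNReal.tsum_mul_left,
          ENNReal.tsum_mul_left, ENNReal.tsum_mul_left, hN, hN, ← ofReal_norm_sq_eq_tsum]
        ring

theorem norm_exp_sub_exp_le (a b : ℝ) :
    ‖Complex.exp ((a : ℂ) * Complex.I) - Complex.exp ((b : ℂ) * Complex.I)‖ ≤ |a - b| := by
  have h : Complex.exp ((a : ℂ) * Complex.I) - Complex.exp ((b : ℂ) * Complex.I) =
      Complex.exp ((b : ℂ) * Complex.I) * (Complex.exp (Complex.I * ((a - b : ℝ) : ℂ)) - 1) := by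
    rw [mul_sub, mul_one, ← Complex.exp_add]
    congr 2
    push_cast
    ring
  rw [h, norm_mul, Complex.norm_exp_ofReal_mul_I, one_mul]
  exact Real.norm_exp_I_mul_ofReal_sub_one_le

/-- The cutoff to a window around `γ₁ = k`, combined with the gauge transformation that makes the
fluxes `Φ` and `Φ - ε` agree in the middle of the window. -/
noncomputable def windowWeight (M : ℕ) (ε : ℝ) (k : ℤ) (γ : ℤ × ℤ) : ℂ :=
  (tent M (γ.1 - k) : ℂ) * Complex.exp (((ε * k * γ.2 : ℝ) : ℂ) * Complex.I)

theorem norm_windowWeight (M : ℕ) (ε : ℝ) (k : ℤ) (γ : ℤ × ℤ) :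
    ‖windowWeight M ε k γ‖ = tent M (γ.1 - k) := by
  rw [windowWeight, norm_mul, Complex.norm_exp_ofReal_mul_I, mul_one, Complex.norm_real,
    Real.norm_of_nonneg (tent_nonneg _ _)]

/-- The window around `γ₁ = k` of an element of `ℓ²(ℤ²)`, in the gauge of `windowWeight`. -/
noncomputable def window (M : ℕ) (ε : ℝ) (k : ℤ) (u : EllTwo) : EllTwo :=
  mulLeOne (windowWeight M ε k) (fun γ => (norm_windowWeight M ε k γ).trans_le (tent_le_one _ _)) u

theorem window_apply (M : ℕ) (ε : ℝ) (k : ℤ) (u : EllTwo) (γ : ℤ × ℤ) :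
    window M ε k u γ = windowWeight M ε k γ * u γ := rfl

theorem tsum_norm_window_sq (M : ℕ) (ε : ℝ) (u : EllTwo) :
    ∑' k, ENNReal.ofReal (‖window M ε k u‖ ^ 2) = tentMass M * ENNReal.ofReal (‖u‖ ^ 2) := by
  simp_rw [ofReal_norm_sq_eq_tsum]
  rw [ENNReal.tsum_comm, ← ENNReal.tsum_mul_left]
  refine tsum_congr fun γ => ?_
  simp_rw [window_apply, norm_mul, norm_windowWeight, mul_pow]
  simp_rw [ENNReal.ofReal_mul (sq_nonneg (tent M _))]
  rw [ENNReal.tsum_mul_right]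
  congr 1
  exact (Equiv.subLeft γ.1).tsum_eq fun n => ENNReal.ofReal (tent M n ^ 2)

/-- The three-term algebra behind both commutator estimates. -/
theorem norm_commutator_le {E t t' p p' q r x y c : ℂ} (hE : ‖E‖ = 1) (v w : ℂ)
    (hx : x = v + y + p * w - c) (hr : r = E * (t * v + t' * y + t * (p' * q) * w - t * c)) :
    ‖r‖ ≤ ‖t‖ * ‖x‖ + ‖t' - t‖ * ‖y‖ + ‖t * (p' * q - p)‖ * ‖w‖ := by
  have h : r = E * (t * x + (t' - t) * y + t * (p' * q - p) * w) := by
    rw [hr, hx]; ring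
  rw [h, norm_mul, hE, one_mul, ← norm_mul, ← norm_mul, ← norm_mul]
  exact norm_add₃_le

theorem norm_hop_window_le (M : ℕ) (Φ Φ' s : ℝ) (u v : EllTwo) (k : ℤ) (γ : ℤ × ℤ) :
    ‖(hop Φ' (window M (Φ - Φ') k v) - (s : ℂ) • window M (Φ - Φ') k u) γ‖ ≤
      tent M (γ.1 - k) * ‖(hop Φ v - (s : ℂ) • u) γ‖ +
      |tent M (γ.1 - k + (-1)) - tent M (γ.1 - k)| * ‖v (γ - (1, 0))‖ +
      |tent M (γ.1 - k) * ((Φ - Φ') * (γ.1 - k : ℤ))| * ‖v (γ - (0, 1))‖ := by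
  have h := norm_commutator_le
    (E := Complex.exp ((((Φ - Φ') * k * γ.2 : ℝ) : ℂ) * Complex.I))
    (t := (tent M (γ.1 - k) : ℂ)) (t' := (tent M (γ.1 - k + (-1)) : ℂ))
    (p := Complex.exp (((-(Φ * (γ.1 : ℝ)) : ℝ) : ℂ) * Complex.I))
    (p' := Complex.exp (((-(Φ' * (γ.1 : ℝ)) : ℝ) : ℂ) * Complex.I))
    (q := Complex.exp (((-((Φ - Φ') * k) : ℝ) : ℂ) * Complex.I))
    (r := (hop Φ' (window M (Φ - Φ') k v) - (s : ℂ) • window M (Φ - Φ') k u) γ)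
    (x := (hop Φ v - (s : ℂ) • u) γ) (y := v (γ - (1, 0))) (c := (s : ℂ) * u γ)
    (Complex.norm_exp_ofReal_mul_I _) (v γ) (v (γ - (0, 1)))
    (by
      change hop Φ v γ - (s : ℂ) * u γ = _
      rw [hop_apply])
    (by
      change hop Φ' (window M (Φ - Φ') k v) γ - (s : ℂ) * (window M (Φ - Φ') k u) γ = _
      rw [hop_apply, window_apply, window_apply, window_apply, window_apply]
      simp only [windowWeight, Prod.fst_sub, Prod.snd_sub, sub_zero]
      have e1 : γ.1 - 1 - k = γ.1 - k + -1 := by ring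
      have e2 : Complex.exp ((((Φ - Φ') * k * ((γ.2 - 1 : ℤ) : ℝ) : ℝ) : ℂ) * Complex.I) =
          Complex.exp ((((Φ - Φ') * k * γ.2 : ℝ) : ℂ) * Complex.I) *
            Complex.exp (((-((Φ - Φ') * k) : ℝ) : ℂ) * Complex.I) := by
        rw [← Complex.exp_add]
        congr 1
        push_cast
        ring
      rw [e1, e2]
      ring)
  refine h.trans ?_
  rw [Complex.norm_real, Real.norm_of_nonneg (tent_nonneg _ _), ← Complex.ofReal_sub,
    Complex.norm_real, Real.norm_eq_abs, norm_mul, Complex.norm_real,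
    Real.norm_of_nonneg (tent_nonneg _ _), abs_mul, abs_of_nonneg (tent_nonneg M (γ.1 - k)),
    ← Complex.exp_add, ← add_mul, ← Complex.ofReal_add]
  have := norm_exp_sub_exp_le (-(Φ' * (γ.1 : ℝ)) + -((Φ - Φ') * k)) (-(Φ * (γ.1 : ℝ)))
  have e3 : -(Φ' * (γ.1 : ℝ)) + -((Φ - Φ') * k) - -(Φ * (γ.1 : ℝ)) =
      (Φ - Φ') * ((γ.1 - k : ℤ) : ℝ) := by
    push_cast
    ring
  rw [e3] at this
  have ht := tent_nonneg M (γ.1 - k)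
  gcongr

theorem norm_adjoint_hop_window_le (M : ℕ) (Φ Φ' s : ℝ) (u v : EllTwo) (k : ℤ) (γ : ℤ × ℤ) :
    ‖(ContinuousLinearMap.adjoint (hop Φ') (window M (Φ - Φ') k u) -
        (s : ℂ) • window M (Φ - Φ') k v) γ‖ ≤
      tent M (γ.1 - k) * ‖(ContinuousLinearMap.adjoint (hop Φ) u - (s : ℂ) • v) γ‖ +
      |tent M (γ.1 - k + 1) - tent M (γ.1 - k)| * ‖u (γ + (1, 0))‖ +
      |tent M (γ.1 - k) * ((Φ - Φ') * (γ.1 - k : ℤ))| * ‖u (γ + (0, 1))‖ := by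
  have h := norm_commutator_le
    (E := Complex.exp ((((Φ - Φ') * k * γ.2 : ℝ) : ℂ) * Complex.I))
    (t := (tent M (γ.1 - k) : ℂ)) (t' := (tent M (γ.1 - k + 1) : ℂ))
    (p := Complex.exp (((Φ * (γ.1 : ℝ) : ℝ) : ℂ) * Complex.I))
    (p' := Complex.exp (((Φ' * (γ.1 : ℝ) : ℝ) : ℂ) * Complex.I))
    (q := Complex.exp ((((Φ - Φ') * k : ℝ) : ℂ) * Complex.I))
    (r := (ContinuousLinearMap.adjoint (hop Φ') (window M (Φ - Φ') k u) -
        (s : ℂ) • window M (Φ - Φ') k v) γ)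
    (x := (ContinuousLinearMap.adjoint (hop Φ) u - (s : ℂ) • v) γ) (y := u (γ + (1, 0)))
    (c := (s : ℂ) * v γ) (Complex.norm_exp_ofReal_mul_I _) (u γ) (u (γ + (0, 1)))
    (by
      change ContinuousLinearMap.adjoint (hop Φ) u γ - (s : ℂ) * v γ = _
      rw [adjoint_hop_apply])
    (by
      change ContinuousLinearMap.adjoint (hop Φ') (window M (Φ - Φ') k u) γ -
        (s : ℂ) * (window M (Φ - Φ') k v) γ = _
      rw [adjoint_hop_apply, window_apply, window_apply, window_apply, window_apply]
      simp only [windowWeight, Prod.fst_add, Prod.snd_add, add_zero]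
      have e1 : γ.1 + 1 - k = γ.1 - k + 1 := by ring
      have e2 : Complex.exp ((((Φ - Φ') * k * ((γ.2 + 1 : ℤ) : ℝ) : ℝ) : ℂ) * Complex.I) =
          Complex.exp ((((Φ - Φ') * k * γ.2 : ℝ) : ℂ) * Complex.I) *
            Complex.exp ((((Φ - Φ') * k : ℝ) : ℂ) * Complex.I) := by
        rw [← Complex.exp_add]
        congr 1
        push_cast
        ring
      rw [e1, e2]
      ring)
  refine h.trans ?_
  rw [Complex.norm_real, Real.norm_of_nonneg (tent_nonneg _ _), ← Complex.ofReal_sub,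
    Complex.norm_real, Real.norm_eq_abs, norm_mul, Complex.norm_real,
    Real.norm_of_nonneg (tent_nonneg _ _), abs_mul, abs_of_nonneg (tent_nonneg M (γ.1 - k)),
    ← Complex.exp_add, ← add_mul, ← Complex.ofReal_add]
  have := norm_exp_sub_exp_le (Φ' * (γ.1 : ℝ) + (Φ - Φ') * k) (Φ * (γ.1 : ℝ))
  have e3 : Φ' * (γ.1 : ℝ) + (Φ - Φ') * k - Φ * (γ.1 : ℝ) =
      -((Φ - Φ') * ((γ.1 - k : ℤ) : ℝ)) := by
    push_cast
    ring
  rw [e3, abs_neg] at this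
  have ht := tent_nonneg M (γ.1 - k)
  gcongr

/-- The cutoffs of an approximate eigenvector at flux `Φ`, summed over all windows, have small
residual at flux `Φ'`; so one of them is an approximate eigenvector. -/
theorem exists_window {M : ℕ} (hM : 0 < M) {Φ Φ' s η δ : ℝ} {u v : EllTwo}
    (h : ‖hop Φ v - (s : ℂ) • u‖ ^ 2 +
        ‖ContinuousLinearMap.adjoint (hop Φ) u - (s : ℂ) • v‖ ^ 2 < η ^ 2 * (‖u‖ ^ 2 + ‖v‖ ^ 2))
    (hδ : 3 * (η ^ 2 + 4 / M ^ 2 + 4 * (Φ - Φ') ^ 2 * M ^ 2) ≤ δ ^ 2) :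
    ∃ u' v' : EllTwo, ‖hop Φ' v' - (s : ℂ) • u'‖ ^ 2 +
        ‖ContinuousLinearMap.adjoint (hop Φ') u' - (s : ℂ) • v'‖ ^ 2 <
      δ ^ 2 * (‖u'‖ ^ 2 + ‖v'‖ ^ 2) := by
  set ε := Φ - Φ' with hε
  set W := fun k => window M ε k with hW
  by_contra! hcon
  have h1 := tsum_norm_sq_le hM ε (-1) (by norm_num) (Equiv.subRight (1, 0)) (Equiv.subRight (0, 1))
    (hop Φ v - (s : ℂ) • u) v v _ (norm_hop_window_le M Φ Φ' s u v)
  have h2 := tsum_norm_sq_le hM ε 1 (by norm_num) (Equiv.addRight (1, 0)) (Equiv.addRight (0, 1))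
    (ContinuousLinearMap.adjoint (hop Φ) u - (s : ℂ) • v) u u _
    (norm_adjoint_hop_window_le M Φ Φ' s u v)
  have hlow : ENNReal.ofReal (δ ^ 2) * (tentMass M * ENNReal.ofReal (‖u‖ ^ 2) +
      tentMass M * ENNReal.ofReal (‖v‖ ^ 2)) ≤
      ∑' k, ENNReal.ofReal (‖hop Φ' (W k v) - (s : ℂ) • W k u‖ ^ 2) +
      ∑' k, ENNReal.ofReal (‖ContinuousLinearMap.adjoint (hop Φ') (W k u) -
        (s : ℂ) • W k v‖ ^ 2) := by
    rw [← tsum_norm_window_sq M ε u, ← tsum_norm_window_sq M ε v, ← ENNReal.tsum_add,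
      ← ENNReal.tsum_add, ← ENNReal.tsum_mul_left]
    refine ENNReal.tsum_le_tsum fun k => ?_
    rw [← ENNReal.ofReal_add (by positivity) (by positivity), ← ENNReal.ofReal_mul (sq_nonneg _),
      ← ENNReal.ofReal_add (by positivity) (by positivity)]
    exact ENNReal.ofReal_le_ofReal (hcon (W k u) (W k v))
  have h3 := hlow.trans (add_le_add h1 h2)
  have hM' : (0 : ℝ) < M := by exact_mod_cast hM
  obtain ⟨c, hc⟩ : ∃ c : ℝ, tentMass M = ENNReal.ofReal c ∧ 0 < c := by
    refine ⟨(tentMass M).toReal, (ENNReal.ofReal_toReal (tentMass_ne_top hM)).symm, ?_⟩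
    refine ENNReal.toReal_pos (fun h0 => ?_) (tentMass_ne_top hM)
    have := le_tentMass hM
    rw [h0, nonpos_iff_eq_zero, ENNReal.ofReal_eq_zero] at this
    linarith
  obtain ⟨hc, hc0⟩ := hc
  have h3' : (3 : ℝ≥0∞) = ENNReal.ofReal 3 := by simp
  rw [hc, h3'] at h3
  have hR : ∀ x y z : ℝ, 0 ≤ x → 0 ≤ y → 0 ≤ z →
      ENNReal.ofReal 3 * ENNReal.ofReal c * (ENNReal.ofReal x +
        ENNReal.ofReal (4 / M ^ 2) * ENNReal.ofReal y +
        ENNReal.ofReal (4 * ε ^ 2 * M ^ 2) * ENNReal.ofReal z) =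
      ENNReal.ofReal (3 * c * (x + 4 / M ^ 2 * y + 4 * ε ^ 2 * M ^ 2 * z)) := by
    intro x y z hx hy hz
    rw [← ENNReal.ofReal_mul (by positivity), ← ENNReal.ofReal_mul (by positivity),
      ← ENNReal.ofReal_mul (by positivity), ← ENNReal.ofReal_add (by positivity) (by positivity),
      ← ENNReal.ofReal_add (by positivity) (by positivity), ← ENNReal.ofReal_mul (by positivity)]
  rw [hR _ _ _ (by positivity) (by positivity) (by positivity),
    hR _ _ _ (by positivity) (by positivity) (by positivity),
    ← ENNReal.ofReal_mul hc0.le, ← ENNReal.ofReal_mul hc0.le,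
    ← ENNReal.ofReal_add (by positivity) (by positivity), ← ENNReal.ofReal_mul (sq_nonneg _),
    ← ENNReal.ofReal_add (by positivity) (by positivity),
    ENNReal.ofReal_le_ofReal_iff (by positivity)] at h3
  set X := ‖hop Φ v - (s : ℂ) • u‖ ^ 2
  set Y := ‖ContinuousLinearMap.adjoint (hop Φ) u - (s : ℂ) • v‖ ^ 2
  have h4 : c * (δ ^ 2 * (‖u‖ ^ 2 + ‖v‖ ^ 2)) ≤
      c * (3 * ((X + Y) + (4 / M ^ 2 + 4 * ε ^ 2 * M ^ 2) * (‖u‖ ^ 2 + ‖v‖ ^ 2))) := by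
    linarith
  have h5 := le_of_mul_le_mul_left h4 hc0
  have h6 := mul_le_mul_of_nonneg_right hδ (by positivity : 0 ≤ ‖u‖ ^ 2 + ‖v‖ ^ 2)
  nlinarith

/-- Hölder-`1/2` continuity of the spectrum as a function of the flux. -/
theorem exists_mem_spectrum_near {Φ Φ' l : ℝ} (hne : Φ ≠ Φ') (hle : |Φ - Φ'| ≤ 1)
    (hl : (l : ℂ) ∈ spectrum ℂ (QLambda Φ)) :
    ∃ m : ℝ, (m : ℂ) ∈ spectrum ℂ (QLambda Φ') ∧ |3 * l - 3 * m| ≤ 8 * √|Φ - Φ'| := by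
  set ε := |Φ - Φ'| with hε
  have hε0 : 0 < ε := abs_pos.2 (sub_ne_zero.2 hne)
  set r := √ε with hr
  have hr0 : 0 < r := Real.sqrt_pos.2 hε0
  have hrr : r ^ 2 = ε := Real.sq_sqrt hε0.le
  have hr1 : r ≤ 1 := Real.sqrt_le_one.2 hle
  -- The window is chosen of width of order `ε ^ (-1/2)`, balancing the two errors.
  set M := ⌈r⁻¹⌉₊ with hM
  have hMpos : 0 < M := Nat.ceil_pos.2 (inv_pos.2 hr0)
  have hM1 : r⁻¹ ≤ M := Nat.le_ceil _
  have hM2 : (M : ℝ) ≤ 2 * r⁻¹ := by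
    have h1 : (M : ℝ) < r⁻¹ + 1 := Nat.ceil_lt_add_one (inv_pos.2 hr0).le
    have h2 : 1 ≤ r⁻¹ := (one_le_inv₀ hr0).2 hr1
    linarith
  obtain ⟨u, v, huv⟩ := exists_approx_pair_of_mem_spectrum hl hr0
  obtain ⟨u', v', h'⟩ := exists_window (Φ' := Φ') (δ := 8 * r) hMpos huv (by
    have h1 : 4 / (M : ℝ) ^ 2 ≤ 4 * r ^ 2 := by
      calc 4 / (M : ℝ) ^ 2 ≤ 4 / r⁻¹ ^ 2 := by gcongr
        _ = 4 * r ^ 2 := by field_simp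
    have h2 : (Φ - Φ') ^ 2 = (r ^ 2) ^ 2 := by rw [hrr, hε, sq_abs]
    have h3 : 4 * (Φ - Φ') ^ 2 * (M : ℝ) ^ 2 ≤ 16 * r ^ 2 := by
      rw [h2]
      calc 4 * (r ^ 2) ^ 2 * (M : ℝ) ^ 2 ≤ 4 * (r ^ 2) ^ 2 * (2 * r⁻¹) ^ 2 := by gcongr
        _ = 16 * r ^ 2 := by field_simp; ring
    nlinarith [sq_nonneg r])
  exact exists_mem_spectrum_of_approx_pair (by positivity) h'

end Window

/-! ### Determinants of covariant linear pencils and the Chambers formula -/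

open Polynomial in
/-- If conjugation by `K` multiplies `A` by a primitive `q`-th root of unity and fixes `B`, then
`det (X A + B)` is a polynomial in `X ^ q`. -/
theorem coeff_det_pencil_eq_zero {R : Type*} [CommRing R] [Algebra ℂ R] {m : Type*} [Fintype m]
    [DecidableEq m] {q : ℕ} {ω : ℂ} (hω : IsPrimitiveRoot ω q) {A B K : Matrix m m R}
    (hK : IsUnit K.det) (hA : K * A = ω • (A * K)) (hB : K * B = B * K) {k : ℕ}
    (hk : ¬ q ∣ k) : ((X : R[X]) • A.map C + B.map C).det.coeff k = 0 := by
  set w : R := algebraMap ℂ R ω with hw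
  have hA' : K * A = w • (A * K) := by rw [hA, hw, algebraMap_smul]
  set P : R[X] := ((X : R[X]) • A.map C + B.map C).det with hP
  have h1 : P.comp (C w * X) = ((C w * X : R[X]) • A.map C + B.map C).det := by
    change compRingHom (C w * X) P = _
    rw [hP, RingHom.map_det]
    congr 1
    ext i j : 1
    simp only [RingHom.mapMatrix_apply, Matrix.map_apply, Matrix.add_apply, Matrix.smul_apply,
      smul_eq_mul, map_add, map_mul, coe_compRingHom_apply, X_comp, C_comp]
  have h2 : K.map C * ((X : R[X]) • A.map C + B.map C) =
      ((C w * X : R[X]) • A.map C + B.map C) * K.map C := by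
    rw [mul_add, add_mul, Matrix.mul_smul, Matrix.smul_mul, ← Matrix.map_mul, ← Matrix.map_mul,
      ← Matrix.map_mul, ← Matrix.map_mul, hA', hB]
    congr 1
    ext i j : 1
    simp only [Matrix.smul_apply, Matrix.map_apply, smul_eq_mul, C_mul]
    ring
  have h3 : P = P.comp (C w * X) := by
    have h4 := congrArg Matrix.det h2
    rw [Matrix.det_mul, Matrix.det_mul, ← hP, ← h1, mul_comm] at h4
    have hu : IsUnit (K.map C : Matrix m m R[X]).det := by
      have : (K.map C : Matrix m m R[X]).det = C K.det := by
        rw [RingHom.map_det]; rfl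
      rw [this]
      exact hK.map C
    exact hu.mul_right_cancel h4
  have h5 : P.coeff k = P.coeff k * w ^ k := by
    conv_lhs => rw [h3, comp_C_mul_X_coeff]
  have h6 : IsUnit (1 - w ^ k) := by
    rw [hw, ← map_pow, ← map_one (algebraMap ℂ R), ← map_sub]
    refine (IsUnit.mk0 _ (sub_ne_zero.2 fun h => hk ?_)).map _
    exact (hω.pow_eq_one_iff_dvd k).1 h.symm
  refine h6.mul_left_eq_zero.1 ?_
  linear_combination h5

open Polynomial in
theorem eval_det_pencil {R : Type*} [CommRing R] {m : Type*} [Fintype m] [DecidableEq m]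
    (A B : Matrix m m R) (y : R) :
    ((X : R[X]) • A.map C + B.map C).det.eval y = (y • A + B).det := by
  change evalRingHom y _ = _
  rw [RingHom.map_det]
  congr 1
  ext i j : 1
  simp only [RingHom.mapMatrix_apply, Matrix.map_apply, Matrix.add_apply, Matrix.smul_apply,
    smul_eq_mul, map_add, coe_evalRingHom, eval_C]
  rw [X_mul_C, eval_mul_X, eval_C, mul_comm]

open Polynomial in
theorem det_add_smul_of_covariant {R : Type*} [CommRing R] [Algebra ℂ R] {n : Type*} [Fintype n]
    [DecidableEq n] [Nonempty n] {ω : ℂ} (hω : IsPrimitiveRoot ω (Fintype.card n))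
    {a D K : Matrix n n R} (hK : IsUnit K.det) (hD : K * D = ω • (D * K)) (ha : K * a = a * K)
    (y : R) : (a + y • D).det = a.det + y ^ Fintype.card n * D.det := by
  have hq : 0 < Fintype.card n := Fintype.card_pos
  rw [add_comm, ← eval_det_pencil]
  set P : R[X] := ((X : R[X]) • D.map C + a.map C).det with hP
  have h : P = C a.det + C D.det * X ^ Fintype.card n := by
    ext k
    rw [coeff_add, coeff_C, coeff_C_mul, coeff_X_pow]
    by_cases h0 : k = 0
    · subst h0
      rw [hP, coeff_det_X_add_C_zero, if_pos rfl, if_neg hq.ne]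
      ring
    by_cases h1 : k = Fintype.card n
    · rw [if_neg h0, if_pos h1, h1, hP, coeff_det_X_add_C_card]
      ring
    rw [if_neg h0, if_neg h1, mul_zero, add_zero]
    by_cases h2 : Fintype.card n < k
    · exact coeff_eq_zero_of_natDegree_lt ((natDegree_det_X_add_C_le D a).trans_lt h2)
    · exact coeff_det_pencil_eq_zero hω hK hD ha fun hd =>
        h1 (le_antisymm (not_lt.1 h2) (Nat.le_of_dvd (Nat.pos_of_ne_zero h0) hd))
  rw [h]
  simp only [eval_add, eval_C, eval_mul, eval_pow, eval_X]
  ring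

/-- Linearisation: up to the unit `det (y D)`, the determinant
`det (l - (a + y D) (a' + y⁻¹ D⁻¹))` is that of a pencil of twice the size, linear in `y`. -/
theorem det_pencil_linearisation {R : Type*} [CommRing R] {n : Type*} [Fintype n]
    [DecidableEq n] {a a' D D' : Matrix n n R} (hDD : D * D' = 1) (l : R) (y : Rˣ) :
    ((y : R) • Matrix.fromBlocks 0 D (D * a') D + Matrix.fromBlocks (l • 1) a 1 0).det =
      (y : R) ^ Fintype.card n * D.det *
        (l • (1 : Matrix n n R) - (a + (y : R) • D) * (a' + (↑y⁻¹ : R) • D')).det := by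
  have hD' : D' * D = 1 := mul_eq_one_comm.1 hDD
  have hyy : (y : R) * ↑y⁻¹ = 1 := y.mul_inv
  let _ : Invertible ((y : R) • D) := ⟨(↑y⁻¹ : R) • D', by
    rw [Matrix.smul_mul, Matrix.mul_smul, smul_smul, hD', mul_comm, hyy, one_smul], by
    rw [Matrix.smul_mul, Matrix.mul_smul, smul_smul, hDD, hyy, one_smul]⟩
  have hinv : ⅟((y : R) • D) = (↑y⁻¹ : R) • D' := rfl
  rw [Matrix.fromBlocks_smul, Matrix.fromBlocks_add, smul_zero, zero_add, add_zero,
    Matrix.det_fromBlocks₂₂, Matrix.det_smul, hinv]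
  congr 3
  rw [Matrix.mul_assoc, add_comm ((y : R) • D) a]
  congr 1
  rw [mul_add, mul_one, Matrix.smul_mul, Matrix.mul_smul, smul_smul, ← Matrix.mul_assoc, hD',
    Matrix.one_mul, mul_comm, hyy, one_smul, add_comm]

open Polynomial in
/-- The dependence on the spectral parameter of `det (l - (a + y D) (a' + y⁻¹ D⁻¹))` does not
involve `y`: in the linearised pencil only the powers `0`, `q`, `2q` of `y` occur, and the
coefficients of the two extreme ones do not contain `l`. -/
theorem det_sub_det_eq_of_covariant {R : Type*} [CommRing R] [Algebra ℂ R] {n : Type*} [Fintype n]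
    [DecidableEq n] [Nonempty n] {ω : ℂ} (hω : IsPrimitiveRoot ω (Fintype.card n))
    {a a' D D' K : Matrix n n R} (hK : IsUnit K.det) (hDD : D * D' = 1)
    (hD : K * D = ω • (D * K)) (ha : K * a = a * K) (ha' : K * a' = a' * K) (l : R) (y z : Rˣ) :
    (l • (1 : Matrix n n R) - (a + (y : R) • D) * (a' + (↑y⁻¹ : R) • D')).det -
        (-((a + (y : R) • D) * (a' + (↑y⁻¹ : R) • D'))).det =
      (l • (1 : Matrix n n R) - (a + (z : R) • D) * (a' + (↑z⁻¹ : R) • D')).det -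
        (-((a + (z : R) • D) * (a' + (↑z⁻¹ : R) • D'))).det := by
  set q := Fintype.card n with hq
  have hq0 : 0 < q := Fintype.card_pos
  set A : Matrix (n ⊕ n) (n ⊕ n) R := Matrix.fromBlocks 0 D (D * a') D with hA
  set B : R → Matrix (n ⊕ n) (n ⊕ n) R := fun l => Matrix.fromBlocks (l • 1) a 1 0 with hB
  set P : R → R[X] := fun l => ((X : R[X]) • A.map C + (B l).map C).det with hP
  set K₂ : Matrix (n ⊕ n) (n ⊕ n) R := Matrix.fromBlocks K 0 0 K with hK₂
  have hKu : IsUnit K₂.det := by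
    rw [hK₂, Matrix.det_fromBlocks_zero₂₁]
    exact hK.mul hK
  have hKA : K₂ * A = ω • (A * K₂) := by
    rw [hK₂, hA, Matrix.fromBlocks_multiply, Matrix.fromBlocks_multiply, Matrix.fromBlocks_smul]
    congr 1 <;> simp [hD, ← Matrix.mul_assoc]
    rw [Matrix.mul_assoc D K, ha', Matrix.mul_assoc]
  have hKB : ∀ l, K₂ * B l = B l * K₂ := by
    intro l
    rw [hK₂, hB, Matrix.fromBlocks_multiply, Matrix.fromBlocks_multiply]
    congr 1 <;> simp [ha]
  have hB0 : ∀ l, (B l).det = (B 0).det := by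
    intro l
    have h : Matrix.fromBlocks 1 (-(l • 1)) 0 1 * B l = B 0 := by
      rw [hB, Matrix.fromBlocks_multiply]
      congr 1 <;> simp
    rw [← h, Matrix.det_mul, Matrix.det_fromBlocks_zero₂₁]
    simp
  have hPl : P l - P 0 = C ((P l).coeff q - (P 0).coeff q) * X ^ q := by
    ext k
    rw [coeff_sub, coeff_C_mul, coeff_X_pow]
    by_cases hkq : k = q
    · rw [hkq, if_pos rfl, mul_one]
    rw [if_neg hkq, mul_zero]
    by_cases hd : q ∣ k
    · obtain ⟨c, rfl⟩ := hd
      rcases c with _ | _ | _ | c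
      · rw [mul_zero, hP]
        simp only [coeff_det_X_add_C_zero]
        rw [hB0, sub_self]
      · simp at hkq
      · have h2 : q * (0 + 1 + 1) = Fintype.card (n ⊕ n) := by
          rw [Fintype.card_sum]; ring
        rw [h2, hP]
        simp only [coeff_det_X_add_C_card]
        rw [sub_self]
      · have h2 : ∀ l, (P l).coeff (q * (c + 1 + 1 + 1)) = 0 := fun l => by
          refine coeff_eq_zero_of_natDegree_lt ((natDegree_det_X_add_C_le A (B l)).trans_lt ?_)
          rw [Fintype.card_sum]
          nlinarith [Nat.zero_le (q * c)]
        rw [h2, h2, sub_self]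
    · rw [hP]
      simp only [coeff_det_pencil_eq_zero hω hKu hKA (hKB _) hd, sub_self]
  have key : ∀ y : Rˣ, D.det * ((l • (1 : Matrix n n R) - (a + (y : R) • D) *
      (a' + (↑y⁻¹ : R) • D')).det - (-((a + (y : R) • D) * (a' + (↑y⁻¹ : R) • D'))).det) =
      (P l).coeff q - (P 0).coeff q := by
    intro y
    have hev : ∀ l, (P l).eval (y : R) = (y : R) ^ q * D.det * (l • (1 : Matrix n n R) -
        (a + (y : R) • D) * (a' + (↑y⁻¹ : R) • D')).det := fun l =>
      (eval_det_pencil _ _ _).trans (det_pencil_linearisation hDD l y)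
    have h1 := congrArg (eval (y : R)) hPl
    rw [eval_sub, eval_mul, eval_C, eval_pow, eval_X, hev, hev, zero_smul, zero_sub] at h1
    refine (y.isUnit.pow q).mul_left_cancel ?_
    rw [mul_comm _ ((P l).coeff q - (P 0).coeff q), ← mul_assoc]
    refine Eq.trans ?_ h1
    ring
  have hDu : IsUnit D.det := IsUnit.of_mul_eq_one D'.det (by
    rw [← Matrix.det_mul, hDD, Matrix.det_one])
  exact hDu.mul_left_cancel ((key y).trans (key z).symm)

/-- The cyclic shift matrix `e_j ↦ e_{j+1}` of size `m + 1`. -/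
noncomputable def cyc (m : ℕ) : Matrix (Fin (m + 1)) (Fin (m + 1)) ℂ :=
  Matrix.of fun i j => if i = j + 1 then 1 else 0

/-- The clock matrix `diag (ζ ^ j)` of size `m + 1`. -/
noncomputable def clock (m : ℕ) (ζ : ℂ) : Matrix (Fin (m + 1)) (Fin (m + 1)) ℂ :=
  Matrix.diagonal fun j => ζ ^ (j : ℕ)

theorem pow_val_add_one {m : ℕ} {ζ : ℂ} (hζ : ζ ^ (m + 1) = 1) (j : Fin (m + 1)) :
    ζ ^ ((j + 1 : Fin (m + 1)) : ℕ) = ζ * ζ ^ (j : ℕ) := by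
  rw [Fin.val_add, ← pow_eq_pow_mod _ hζ, pow_add, mul_comm]
  congr 1
  rw [Fin.val_one', ← pow_eq_pow_mod _ hζ, pow_one]

theorem clock_mul_cyc {m : ℕ} {ζ : ℂ} (hζ : ζ ^ (m + 1) = 1) :
    clock m ζ * cyc m = ζ • (cyc m * clock m ζ) := by
  ext i j
  rw [clock, Matrix.diagonal_mul, Matrix.smul_apply, Matrix.mul_diagonal, cyc, Matrix.of_apply]
  split_ifs with h
  · rw [h, pow_val_add_one hζ, smul_eq_mul]; ring
  · simp

theorem cyc_mul_transpose (m : ℕ) : cyc m * (cyc m).transpose = 1 := by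
  ext i j
  rw [Matrix.mul_apply, Finset.sum_eq_single (i - 1)]
  · simp only [cyc, Matrix.transpose_apply, Matrix.of_apply, sub_add_cancel, if_true, one_mul,
      Matrix.one_apply]
    exact if_congr eq_comm rfl rfl
  · intro b _ hb
    have : i ≠ b + 1 := fun h => hb (by rw [h, add_sub_cancel_right])
    simp [cyc, this]
  · simp

theorem clock_mul_clock_inv {m : ℕ} {ζ : ℂ} (hζ : ζ ≠ 0) : clock m ζ * clock m ζ⁻¹ = 1 := by
  rw [clock, clock, Matrix.diagonal_mul_diagonal, ← Matrix.diagonal_one]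
  congr 1
  ext i
  rw [← mul_pow, mul_inv_cancel₀ hζ, one_pow]

section Bloch

variable {R : Type*} [CommRing R] [Algebra ℂ R]

/-- The Bloch matrix `1 + x S + y D` of the hopping operator, with quasimomenta `x`, `y` in an
arbitrary commutative `ℂ`-algebra. -/
noncomputable def bloch (m : ℕ) (ζ : ℂ) (x y : R) : Matrix (Fin (m + 1)) (Fin (m + 1)) R :=
  1 + x • (cyc m).map (algebraMap ℂ R) + y • (clock m ζ).map (algebraMap ℂ R)

/-- The Bloch matrix `1 + x S⁻¹ + y D⁻¹` of the adjoint hopping operator. -/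
noncomputable def blochAdj (m : ℕ) (ζ : ℂ) (x y : R) : Matrix (Fin (m + 1)) (Fin (m + 1)) R :=
  1 + x • (cyc m).transpose.map (algebraMap ℂ R) + y • (clock m ζ⁻¹).map (algebraMap ℂ R)

theorem map_mul_map_eq_one {m : ℕ} {A B : Matrix (Fin (m + 1)) (Fin (m + 1)) ℂ} (h : A * B = 1) :
    A.map (algebraMap ℂ R) * B.map (algebraMap ℂ R) = 1 := by
  rw [← Matrix.map_mul, h, Matrix.map_one _ (map_zero _) (map_one _)]

theorem isUnit_det_map {m : ℕ} {A B : Matrix (Fin (m + 1)) (Fin (m + 1)) ℂ} (h : A * B = 1) :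
    IsUnit (A.map (algebraMap ℂ R)).det :=
  IsUnit.of_mul_eq_one (B.map (algebraMap ℂ R)).det (by
    rw [← Matrix.det_mul, map_mul_map_eq_one h, Matrix.det_one])

theorem map_covariant {m : ℕ} {A B : Matrix (Fin (m + 1)) (Fin (m + 1)) ℂ} {c : ℂ}
    (h : A * B = c • (B * A)) :
    A.map (algebraMap ℂ R) * B.map (algebraMap ℂ R) =
      c • (B.map (algebraMap ℂ R) * A.map (algebraMap ℂ R)) := by
  rw [← Matrix.map_mul, ← Matrix.map_mul, h]
  ext i j
  rw [Matrix.smul_apply, Matrix.map_apply, Matrix.map_apply, Matrix.smul_apply,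
    smul_eq_mul, map_mul, Algebra.smul_def]

theorem cyc_mul_clock {m : ℕ} {ζ : ℂ} (hζ : ζ ^ (m + 1) = 1) :
    cyc m * clock m ζ = ζ⁻¹ • (clock m ζ * cyc m) := by
  have h0 : ζ ≠ 0 := by
    rintro rfl
    simp at hζ
  rw [clock_mul_cyc hζ, smul_smul, inv_mul_cancel₀ h0, one_smul]

theorem commute_transpose_cyc (m : ℕ) : cyc m * (cyc m).transpose = (cyc m).transpose * cyc m :=
  (cyc_mul_transpose m).trans (mul_eq_one_comm.1 (cyc_mul_transpose m)).symm

theorem det_bloch {m : ℕ} {ζ : ℂ} (hζ : IsPrimitiveRoot ζ (m + 1)) (x y : R) :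
    (bloch m ζ x y).det = 1 + x ^ (m + 1) * algebraMap ℂ R (cyc m).det +
      y ^ (m + 1) * algebraMap ℂ R (clock m ζ).det := by
  have h0 : ζ ≠ 0 := hζ.ne_zero (by omega)
  have hdet : ∀ A : Matrix (Fin (m + 1)) (Fin (m + 1)) ℂ,
      (A.map (algebraMap ℂ R)).det = algebraMap ℂ R A.det := fun A => by
    rw [RingHom.map_det]; rfl
  rw [bloch, det_add_smul_of_covariant (ω := ζ⁻¹) (K := (cyc m).map (algebraMap ℂ R))
    (by simpa using hζ.inv) (isUnit_det_map (cyc_mul_transpose m))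
    (map_covariant (cyc_mul_clock hζ.pow_eq_one)) (by simp [mul_add, add_mul]),
    det_add_smul_of_covariant (ω := ζ) (K := (clock m ζ).map (algebraMap ℂ R))
    (by simpa using hζ) (isUnit_det_map (clock_mul_clock_inv h0))
    (map_covariant (clock_mul_cyc hζ.pow_eq_one)) (by simp), hdet, hdet]
  simp

theorem det_blochAdj {m : ℕ} {ζ : ℂ} (hζ : IsPrimitiveRoot ζ (m + 1)) (x y : R) :
    (blochAdj m ζ x y).det = 1 + x ^ (m + 1) * algebraMap ℂ R (cyc m).transpose.det +
      y ^ (m + 1) * algebraMap ℂ R (clock m ζ⁻¹).det := by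
  have e : (blochAdj m ζ x y).transpose = bloch m ζ⁻¹ x y := by
    rw [blochAdj, bloch]
    simp only [Matrix.transpose_add, Matrix.transpose_one, Matrix.transpose_smul,
      ← Matrix.transpose_map, Matrix.transpose_transpose]
    rw [clock, Matrix.diagonal_transpose]
  rw [← Matrix.det_transpose, e, det_bloch hζ.inv, Matrix.det_transpose]

theorem det_sub_bloch_x {m : ℕ} {ζ : ℂ} (hζ : IsPrimitiveRoot ζ (m + 1)) (l : R) (x z y : Rˣ) :
    (l • 1 - bloch m ζ (x : R) y * blochAdj m ζ (↑x⁻¹ : R) ↑y⁻¹).det -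
      (-(bloch m ζ (x : R) y * blochAdj m ζ (↑x⁻¹ : R) ↑y⁻¹)).det =
    (l • 1 - bloch m ζ (z : R) y * blochAdj m ζ (↑z⁻¹ : R) ↑y⁻¹).det -
      (-(bloch m ζ (z : R) y * blochAdj m ζ (↑z⁻¹ : R) ↑y⁻¹)).det := by
  have h0 : ζ ≠ 0 := hζ.ne_zero (by omega)
  have h := det_sub_det_eq_of_covariant (R := R) (ω := ζ) (n := Fin (m + 1))
    (a := 1 + (y : R) • (clock m ζ).map (algebraMap ℂ R))
    (a' := 1 + (↑y⁻¹ : R) • (clock m ζ⁻¹).map (algebraMap ℂ R))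
    (D := (cyc m).map (algebraMap ℂ R)) (D' := (cyc m).transpose.map (algebraMap ℂ R))
    (K := (clock m ζ).map (algebraMap ℂ R)) (by simpa using hζ)
    (isUnit_det_map (clock_mul_clock_inv h0)) (map_mul_map_eq_one (cyc_mul_transpose m))
    (map_covariant (clock_mul_cyc hζ.pow_eq_one)) (by simp [mul_add, add_mul]) (by
      simp only [mul_add, add_mul, mul_one, one_mul, Matrix.mul_smul, Matrix.smul_mul]
      rw [map_mul_map_eq_one (clock_mul_clock_inv h0),
        map_mul_map_eq_one (mul_eq_one_comm.1 (clock_mul_clock_inv h0))]) l x z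
  simpa only [bloch, blochAdj, add_right_comm] using h

theorem det_sub_bloch_y {m : ℕ} {ζ : ℂ} (hζ : IsPrimitiveRoot ζ (m + 1)) (l : R) (x y z : Rˣ) :
    (l • 1 - bloch m ζ (x : R) y * blochAdj m ζ (↑x⁻¹ : R) ↑y⁻¹).det -
      (-(bloch m ζ (x : R) y * blochAdj m ζ (↑x⁻¹ : R) ↑y⁻¹)).det =
    (l • 1 - bloch m ζ (x : R) z * blochAdj m ζ (↑x⁻¹ : R) ↑z⁻¹).det -
      (-(bloch m ζ (x : R) z * blochAdj m ζ (↑x⁻¹ : R) ↑z⁻¹)).det := by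
  have h0 : ζ ≠ 0 := hζ.ne_zero (by omega)
  exact det_sub_det_eq_of_covariant (R := R) (ω := ζ⁻¹) (n := Fin (m + 1))
    (a := 1 + (x : R) • (cyc m).map (algebraMap ℂ R))
    (a' := 1 + (↑x⁻¹ : R) • (cyc m).transpose.map (algebraMap ℂ R))
    (D := (clock m ζ).map (algebraMap ℂ R)) (D' := (clock m ζ⁻¹).map (algebraMap ℂ R))
    (K := (cyc m).map (algebraMap ℂ R)) (by simpa using hζ.inv)
    (isUnit_det_map (cyc_mul_transpose m)) (map_mul_map_eq_one (clock_mul_clock_inv h0))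
    (map_covariant (cyc_mul_clock hζ.pow_eq_one)) (by simp [mul_add, add_mul]) (by
      simp only [mul_add, add_mul, mul_one, one_mul, Matrix.mul_smul, Matrix.smul_mul]
      rw [← Matrix.map_mul, ← Matrix.map_mul, commute_transpose_cyc]) l y z

/-- The matrix `T T*` at the quasimomentum `x = 1`, `y = -ζ`. As `ζ ^ (m + 1) = 1`, the last entry
of the diagonal part `1 - ζ D` of `bloch` vanishes there, which cuts one link of the periodic
Jacobi matrix. -/
noncomputable def decoupled (m : ℕ) (ζ : ℂ) : Matrix (Fin (m + 1)) (Fin (m + 1)) ℂ :=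
  bloch m ζ 1 (-ζ) * blochAdj m ζ 1 (-ζ)⁻¹

theorem neg_pow_mul_det_clock {m : ℕ} {ζ : ℂ} (hζ : IsPrimitiveRoot ζ (m + 1)) :
    (-ζ) ^ (m + 1) * (clock m ζ).det = -1 := by
  have h := det_bloch (R := ℂ) hζ 0 (-ζ)
  have h1 : (bloch m ζ (0 : ℂ) (-ζ)).det = 0 := by
    have e : bloch m ζ (0 : ℂ) (-ζ) =
        Matrix.diagonal fun j : Fin (m + 1) => 1 + -ζ * ζ ^ (j : ℕ) := by
      ext i j
      by_cases hij : i = j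
      · subst hij
        simp [bloch, clock]
      · simp [bloch, clock, hij]
    rw [e, Matrix.det_diagonal]
    refine Finset.prod_eq_zero (Finset.mem_univ (Fin.last m)) ?_
    rw [Fin.val_last, neg_mul, ← pow_succ', hζ.pow_eq_one, add_neg_cancel]
  rw [h1, zero_pow (by omega), zero_mul, add_zero] at h
  exact (neg_eq_of_add_eq_zero_right h.symm).symm

theorem neg_inv_pow_mul_det_clock_inv {m : ℕ} {ζ : ℂ} (hζ : IsPrimitiveRoot ζ (m + 1)) :
    (-ζ)⁻¹ ^ (m + 1) * (clock m ζ⁻¹).det = -1 := by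
  have h := neg_pow_mul_det_clock hζ.inv
  rwa [← inv_neg] at h

theorem det_neg_decoupled {m : ℕ} {ζ : ℂ} (hζ : IsPrimitiveRoot ζ (m + 1)) :
    (-decoupled m ζ).det = (-1) ^ (m + 1) := by
  rw [Matrix.det_neg, Fintype.card_fin, decoupled, Matrix.det_mul, det_bloch hζ, det_blochAdj hζ]
  simp only [Algebra.algebraMap_self, RingHom.id_apply]
  rw [neg_pow_mul_det_clock hζ, neg_inv_pow_mul_det_clock_inv hζ]
  have h : (cyc m).det * (cyc m).transpose.det = 1 := by
    rw [← Matrix.det_mul, cyc_mul_transpose, Matrix.det_one]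
  linear_combination (-1) ^ (m + 1) * h

/-- The Chambers formula: the characteristic polynomial of the Bloch matrix depends on the
quasimomenta only through an additive constant, an explicit sum of six unitaries and `2`. -/
theorem chambers {m : ℕ} {ζ : ℂ} (hζ : IsPrimitiveRoot ζ (m + 1)) (l : ℂ) (x y : Rˣ) :
    ∃ u v : Rˣ, (u : R) = x ^ (m + 1) * algebraMap ℂ R (cyc m).det ∧
      (v : R) = y ^ (m + 1) * algebraMap ℂ R (clock m ζ).det ∧
      (algebraMap ℂ R l • 1 - bloch m ζ (x : R) y * blochAdj m ζ (↑x⁻¹ : R) ↑y⁻¹).det =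
        algebraMap ℂ R (l • 1 - decoupled m ζ).det +
          (-1) ^ (m + 1) * (2 + u + v + ↑u⁻¹ + ↑v⁻¹ + u * ↑v⁻¹ + v * ↑u⁻¹) := by
  have h0 : ζ ≠ 0 := hζ.ne_zero (by omega)
  have hsm : ∀ (c : ℂ) (r : R), c • r = algebraMap ℂ R c * r := Algebra.smul_def
  have hS : algebraMap ℂ R (cyc m).det * algebraMap ℂ R (cyc m).transpose.det = 1 := by
    rw [← map_mul, ← Matrix.det_mul, cyc_mul_transpose, Matrix.det_one, map_one]
  have hD : algebraMap ℂ R (clock m ζ).det * algebraMap ℂ R (clock m ζ⁻¹).det = 1 := by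
    rw [← map_mul, ← Matrix.det_mul, clock_mul_clock_inv h0, Matrix.det_one, map_one]
  let u : Rˣ := x ^ (m + 1) * ⟨_, _, hS, by rw [mul_comm, hS]⟩
  let v : Rˣ := y ^ (m + 1) * ⟨_, _, hD, by rw [mul_comm, hD]⟩
  refine ⟨u, v, rfl, rfl, ?_⟩
  have e1 : (bloch m ζ (x : R) y).det = 1 + u + v := det_bloch hζ _ _
  have e2 : (blochAdj m ζ (↑x⁻¹ : R) ↑y⁻¹).det = 1 + ↑u⁻¹ + ↑v⁻¹ := by
    rw [det_blochAdj hζ]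
    have hu : (↑u⁻¹ : R) = (↑x⁻¹ : R) ^ (m + 1) * algebraMap ℂ R (cyc m).transpose.det := by
      refine (Units.eq_inv_of_mul_eq_one_left ?_).symm
      rw [mul_comm]
      change _ * ((x : R) ^ (m + 1) * algebraMap ℂ R (cyc m).det) = 1
      rw [mul_mul_mul_comm, ← mul_pow, Units.inv_mul, one_pow, one_mul, mul_comm, hS]
    have hv : (↑v⁻¹ : R) = (↑y⁻¹ : R) ^ (m + 1) * algebraMap ℂ R (clock m ζ⁻¹).det := by
      refine (Units.eq_inv_of_mul_eq_one_left ?_).symm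
      rw [mul_comm]
      change _ * ((y : R) ^ (m + 1) * algebraMap ℂ R (clock m ζ).det) = 1
      rw [mul_mul_mul_comm, ← mul_pow, Units.inv_mul, one_pow, one_mul, mul_comm, hD]
    rw [hu, hv]
  let y₀ : Rˣ := Units.map (algebraMap ℂ R : ℂ →* R) (Units.mk0 (-ζ) (neg_ne_zero.2 h0))
  have hmap : bloch m ζ ((1 : Rˣ) : R) y₀ * blochAdj m ζ (↑(1 : Rˣ)⁻¹ : R) ↑y₀⁻¹ =
      (decoupled m ζ).map (algebraMap ℂ R) := by
    have hy : (y₀ : R) = algebraMap ℂ R (-ζ) := rfl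
    have hy' : (↑y₀⁻¹ : R) = algebraMap ℂ R (-ζ)⁻¹ := rfl
    rw [decoupled, Matrix.map_mul, hy, hy', inv_one, Units.val_one]
    congr 1
    · ext i j
      simp [bloch, Matrix.one_apply, apply_ite (algebraMap ℂ R), hsm]
    · ext i j
      simp [blochAdj, Matrix.one_apply, apply_ite (algebraMap ℂ R), hsm]
  have h1 := (det_sub_bloch_x hζ (algebraMap ℂ R l) x 1 y).trans
    (det_sub_bloch_y hζ (algebraMap ℂ R l) 1 y y₀)
  rw [hmap, Matrix.det_neg, Matrix.det_mul, e1, e2, Fintype.card_fin] at h1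
  have h2 : (algebraMap ℂ R l • 1 - (decoupled m ζ).map (algebraMap ℂ R)).det =
      algebraMap ℂ R (l • 1 - decoupled m ζ).det := by
    rw [RingHom.map_det]
    congr 1
    ext i j
    simp [Matrix.one_apply, apply_ite (algebraMap ℂ R), hsm]
  have h3 : (-(decoupled m ζ).map (algebraMap ℂ R)).det = (-1) ^ (m + 1) := by
    have := congrArg (algebraMap ℂ R) (det_neg_decoupled hζ)
    rw [RingHom.map_det, map_pow, map_neg, map_neg, map_one] at this
    exact this
  rw [h2, h3] at h1
  have hu : (u : R) * ↑u⁻¹ = 1 := u.mul_inv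
  have hv : (v : R) * ↑v⁻¹ = 1 := v.mul_inv
  linear_combination h1 + (-1) ^ (m + 1) * (hu + hv)

end Bloch

/-! ### The decoupled Jacobi matrix -/

theorem bloch_mul_apply {m : ℕ} {ζ : ℂ} (N : Matrix (Fin (m + 1)) (Fin (m + 1)) ℂ)
    (i j : Fin (m + 1)) :
    (bloch m ζ (1 : ℂ) (-ζ) * N) i j = (1 - ζ ^ ((i : ℕ) + 1)) * N i j + N (i - 1) j := by
  have h : bloch m ζ (1 : ℂ) (-ζ) = Matrix.diagonal (fun i : Fin (m + 1) => 1 - ζ ^ ((i : ℕ) + 1))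
      + cyc m := by
    ext i j
    by_cases hij : i = j
    · subst hij
      simp [bloch, clock, pow_succ']
      ring
    · simp [bloch, clock, hij]
  rw [h, add_mul, Matrix.add_apply, Matrix.diagonal_mul, Matrix.mul_apply,
    Finset.sum_eq_single (i - 1)]
  · simp [cyc]
  · intro b _ hb
    have : i ≠ b + 1 := fun h => hb (by rw [h, add_sub_cancel_right])
    simp [cyc, this]
  · simp

theorem blochAdj_apply {m : ℕ} {ζ : ℂ} (i j : Fin (m + 1)) :
    blochAdj m ζ (1 : ℂ) (-ζ)⁻¹ i j =
      (if i = j then 1 - ζ⁻¹ ^ ((j : ℕ) + 1) else 0) + if j = i + 1 then 1 else 0 := by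
  by_cases hij : i = j
  · subst hij
    simp [blochAdj, clock, cyc, pow_succ', inv_neg]
    ring
  · simp [blochAdj, clock, cyc, hij]

theorem decoupled_isHermitian {m : ℕ} {ζ : ℂ} (hζ : ‖ζ‖ = 1) : (decoupled m ζ).IsHermitian := by
  have hc : (starRingEnd ℂ) ζ = ζ⁻¹ := (Complex.inv_eq_conj hζ).symm
  have h : blochAdj m ζ (1 : ℂ) (-ζ)⁻¹ = (bloch m ζ (1 : ℂ) (-ζ)).conjTranspose := by
    ext i j
    by_cases hij : i = j
    · subst hij
      simp [blochAdj, bloch, clock, cyc, inv_neg, hc, apply_ite (starRingEnd ℂ)]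
    · have hij' : j ≠ i := fun h => hij h.symm
      simp [blochAdj, bloch, clock, cyc, hij, hij', apply_ite (starRingEnd ℂ)]
  rw [decoupled, h]
  exact Matrix.isHermitian_mul_conjTranspose_self _

/-- Above the diagonal, the matrix `decoupled` has only the entries `1 - ζ ^ (i + 1)` next to the
diagonal: it is a Jacobi matrix, the corner entry being cancelled by `ζ ^ (m + 1) = 1`. -/
theorem decoupled_castSucc_succ {m : ℕ} {ζ : ℂ} (hζ : IsPrimitiveRoot ζ (m + 1)) {i j : Fin m}
    (hij : i ≤ j) :
    decoupled m ζ i.castSucc j.succ = if i = j then 1 - ζ ^ ((i : ℕ) + 1) else 0 := by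
  have h1 : i.castSucc ≠ j.succ := (Fin.castSucc_lt_succ_iff.2 hij).ne
  have h2 : i.castSucc + 1 = i.succ := Fin.coeSucc_eq_succ
  have h3 : (if i.castSucc - 1 = j.succ then 1 - ζ⁻¹ ^ ((j.succ : ℕ) + 1) else 0) = 0 := by
    split_ifs with h
    · have hj : i.castSucc = j.succ + 1 := by rw [← h, sub_add_cancel]
      have : (j.succ : ℕ) + 1 = m + 1 := by
        by_contra hne
        have hlt : (j.succ : ℕ) + 1 < m + 1 := by
          have := j.succ.2
          omega
        have hv := congrArg Fin.val hj
        rw [Fin.val_add_one_of_lt' hlt] at hv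
        simp only [Fin.val_castSucc, Fin.val_succ] at hv
        have : (i : ℕ) ≤ j := hij
        omega
      rw [this, inv_pow, hζ.pow_eq_one, inv_one, sub_self]
    · rfl
  rw [decoupled, bloch_mul_apply, blochAdj_apply, blochAdj_apply, if_neg h1, h2, h3,
    sub_add_cancel, if_neg h1.symm, zero_add, add_zero, Fin.val_castSucc]
  by_cases h : i = j
  · simp [h]
  · have : j.succ ≠ i.succ := fun h' => h (Fin.succ_injective _ h').symm
    simp [h, this]

/-- The corner entry of the adjugate of `t - decoupled` is the product of the hopping amplitudes,
of modulus `∏ |1 - ζ ^ i| = m + 1`. -/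
theorem adjugate_corner {m : ℕ} {ζ : ℂ} (hζ : IsPrimitiveRoot ζ (m + 1)) (t : ℂ) :
    (t • 1 - decoupled m ζ).adjugate 0 (Fin.last m) =
      (-1) ^ m * ∏ k ∈ Finset.range m, -(1 - ζ ^ (k + 1)) := by
  rw [Matrix.adjugate_fin_succ_eq_det_submatrix, Matrix.det_of_isLowerTriangular]
  · rw [Fin.val_last, Fin.val_zero, add_zero]
    congr 1
    rw [← Fin.prod_univ_eq_prod_range (fun k => -(1 - ζ ^ (k + 1)))]
    refine Finset.prod_congr rfl fun i _ => ?_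
    rw [Matrix.submatrix_apply, Fin.succAbove_last, Fin.succAbove_zero, Matrix.sub_apply,
      decoupled_castSucc_succ hζ le_rfl, if_pos rfl, Matrix.smul_apply, Matrix.one_apply_ne,
      smul_zero, zero_sub]
    exact (Fin.castSucc_lt_succ (i := i)).ne
  · intro i j hij
    have hij' : i < j := hij
    rw [Matrix.submatrix_apply, Fin.succAbove_last, Fin.succAbove_zero, Matrix.sub_apply,
      decoupled_castSucc_succ hζ hij'.le, if_neg hij'.ne, Matrix.smul_apply, Matrix.one_apply_ne,
      smul_zero, zero_sub, neg_zero]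
    exact (Fin.castSucc_lt_succ_iff.2 hij'.le).ne

/-- Partial fractions of the reciprocal characteristic polynomial of the decoupled Jacobi matrix.
The total mass of the residues is at most `1 / (m + 1)`: by Cauchy–Schwarz the corner entry of the
resolvent has residues of total mass at most `1`, and it is `(m + 1)` times, up to a phase, the
reciprocal of the characteristic polynomial. -/
theorem exists_partial_fractions {m : ℕ} {ζ : ℂ} (hζ : IsPrimitiveRoot ζ (m + 1)) :
    ∃ l a : Fin (m + 1) → ℝ, ∑ i, |a i| ≤ 1 / (m + 1) ∧ ∀ t : ℝ, (∀ i, t ≠ l i) →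
      ‖((t : ℂ) • 1 - decoupled m ζ).det‖ * |∑ i, a i / (t - l i)| = 1 := by
  have hζ1 : ‖ζ‖ = 1 := hζ.norm'_eq_one (by omega)
  have hJ := decoupled_isHermitian (m := m) hζ1
  set l := hJ.eigenvalues with hl
  set U : Matrix (Fin (m + 1)) (Fin (m + 1)) ℂ := hJ.eigenvectorUnitary.1 with hU
  have hU1 : U * star U = 1 := Unitary.mul_star_self_of_mem hJ.eigenvectorUnitary.2
  have hU2 : star U * U = 1 := Unitary.star_mul_self_of_mem hJ.eigenvectorUnitary.2
  set c : ℂ := (-1) ^ m * ∏ k ∈ Finset.range m, -(1 - ζ ^ (k + 1)) with hc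
  have hcn : ‖c‖ = m + 1 := by
    have h := congrArg norm hζ.prod_one_sub_pow_eq_order
    rw [norm_prod] at h
    rw [hc, norm_mul, norm_pow, norm_neg, norm_one, one_pow, one_mul, norm_prod]
    simp only [norm_neg]
    rw [h]
    exact_mod_cast Complex.norm_natCast (m + 1)
  have hc0 : c ≠ 0 := by
    rw [← norm_pos_iff, hcn]; positivity
  set b : Fin (m + 1) → ℂ := fun j => U 0 j * star (U (Fin.last m) j) / c with hb
  have hrow : ∀ i, ∑ j, ‖U i j‖ ^ 2 = 1 := by
    intro i
    have h := congrFun (congrFun hU1 i) i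
    rw [Matrix.mul_apply, Matrix.one_apply_eq] at h
    have h2 : ∀ j, U i j * (star U) j i = ((‖U i j‖ ^ 2 : ℝ) : ℂ) := fun j => by
      rw [Matrix.star_apply]
      push_cast
      exact Complex.mul_conj' _
    rw [Finset.sum_congr rfl fun j _ => h2 j, ← Complex.ofReal_sum] at h
    exact_mod_cast h
  refine ⟨l, fun j => (b j).re, ?_, ?_⟩
  · have h1 : ∀ j, |(b j).re| ≤ (‖U 0 j‖ * ‖U (Fin.last m) j‖) / (m + 1) := by
      intro j
      refine (Complex.abs_re_le_norm _).trans_eq ?_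
      rw [hb, norm_div, norm_mul, norm_star, hcn]
    refine (Finset.sum_le_sum fun j _ => h1 j).trans ?_
    rw [← Finset.sum_div]
    gcongr
    have h2 := Finset.sum_mul_sq_le_sq_mul_sq Finset.univ (fun j => ‖U 0 j‖)
      (fun j => ‖U (Fin.last m) j‖)
    rw [hrow, hrow, one_mul] at h2
    exact (le_abs_self _).trans ((sq_le_one_iff_abs_le_one _).1 h2)
  · intro t ht
    have ht' : ∀ j, (t : ℂ) - l j ≠ 0 := fun j => by
      rw [← Complex.ofReal_sub, Complex.ofReal_ne_zero]
      exact sub_ne_zero.2 (ht j)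
    set M := (t : ℂ) • (1 : Matrix (Fin (m + 1)) (Fin (m + 1)) ℂ) - decoupled m ζ with hM
    have hspec : M = U * Matrix.diagonal (fun j => (t : ℂ) - l j) * star U := by
      have h1 : decoupled m ζ = U * Matrix.diagonal (fun j => (l j : ℂ)) * star U :=
        hJ.spectral_theorem
      have h2 : Matrix.diagonal (fun j => (t : ℂ) - l j) =
          (t : ℂ) • 1 - Matrix.diagonal (fun j => (l j : ℂ)) := by
        rw [← Matrix.diagonal_one, ← Matrix.diagonal_smul, Matrix.diagonal_sub]
        congr 1
        ext j
        simp
      rw [h2, mul_sub, sub_mul, ← h1, Matrix.mul_smul, mul_one, Matrix.smul_mul, hU1]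
    have hdet : M.det = ((∏ j, (t - l j) : ℝ) : ℂ) := by
      rw [hspec, Matrix.det_mul, Matrix.det_mul, mul_right_comm, ← Matrix.det_mul, hU1,
        Matrix.det_one, one_mul, Matrix.det_diagonal]
      push_cast
      rfl
    set N := U * Matrix.diagonal (fun j => ((t : ℂ) - l j)⁻¹) * star U with hN
    have hMN : M * N = 1 := by
      have h1 : Matrix.diagonal (fun j => (t : ℂ) - l j) *
          Matrix.diagonal (fun j => ((t : ℂ) - l j)⁻¹) = 1 := by
        rw [Matrix.diagonal_mul_diagonal, ← Matrix.diagonal_one]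
        congr 1
        ext j
        exact mul_inv_cancel₀ (ht' j)
      calc M * N = U * (Matrix.diagonal (fun j => (t : ℂ) - l j) * (star U * U) *
            Matrix.diagonal (fun j => ((t : ℂ) - l j)⁻¹)) * star U := by
            rw [hspec, hN]; simp only [Matrix.mul_assoc]
        _ = 1 := by rw [hU2, mul_one, h1, mul_one, hU1]
    have hadj : M.adjugate = M.det • N := by
      calc M.adjugate = M.adjugate * (M * N) := by rw [hMN, mul_one]
        _ = M.det • N := by
          rw [← Matrix.mul_assoc, Matrix.adjugate_mul, Matrix.smul_mul, one_mul]
    have hcorner : c = M.det * ∑ j, U 0 j * star (U (Fin.last m) j) / ((t : ℂ) - l j) := by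
      rw [hc, ← adjugate_corner hζ (t : ℂ), ← hM, hadj, Matrix.smul_apply, smul_eq_mul]
      congr 1
      rw [hN, Matrix.mul_apply]
      refine Finset.sum_congr rfl fun j _ => ?_
      rw [Matrix.mul_diagonal, Matrix.star_apply]
      ring
    have hone : ((∏ j, (t - l j) : ℝ) : ℂ) * ∑ j, b j / ((t - l j : ℝ) : ℂ) = 1 := by
      rw [← hdet]
      refine mul_left_cancel₀ hc0 ?_
      rw [mul_one]
      conv_rhs => rw [hcorner]
      rw [mul_left_comm, Finset.mul_sum]
      congr 1
      refine Finset.sum_congr rfl fun j _ => ?_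
      rw [hb]
      push_cast
      have := ht' j
      field_simp
    have hre := congrArg Complex.re hone
    rw [Complex.re_ofReal_mul, Complex.re_sum, Complex.one_re] at hre
    simp only [Complex.div_ofReal_re] at hre
    rw [hdet, Complex.norm_real, Real.norm_eq_abs, ← abs_mul, hre, abs_one]

/-- The set that contains the values `(3 λ)²`, for `λ` in the spectrum at flux `2π p / q`, is
covered by `3 q` intervals of total length `32 / q`. -/
theorem intervalCover_det_decoupled_le {m : ℕ} {ζ : ℂ} (hζ : IsPrimitiveRoot ζ (m + 1)) :
    IntervalCover (3 * (m + 1)) (32 / (m + 1))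
      {t : ℝ | ‖((t : ℂ) • 1 - decoupled m ζ).det‖ ≤ 8} := by
  obtain ⟨l, a, ha, h⟩ := exists_partial_fractions hζ
  refine (intervalCover_abs_signed_simple_poles l a (t := 1 / 8) (by norm_num)).mono
    (by rw [Fintype.card_fin]) ?_ ?_
  · calc 4 * (∑ i, |a i|) / (1 / 8) = 32 * ∑ i, |a i| := by ring
      _ ≤ 32 * (1 / (m + 1)) := by gcongr
      _ = 32 / (m + 1) := by ring
  · intro t ht
    by_cases hp : ∃ i, t = l i
    · exact Or.inl hp
    · right
      have h1 := h t (not_exists.1 hp)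
      have ht' : ‖((t : ℂ) • 1 - decoupled m ζ).det‖ ≤ 8 := ht
      nlinarith [abs_nonneg (∑ i, a i / (t - l i))]

/-! ### The spectrum at rational flux -/

/-- The translation of `ℓ²(ℤ²)` by `d`. -/
noncomputable def transl (d : ℤ × ℤ) : EllTwo →L[ℂ] EllTwo :=
  (phaseShift (fun _ => 1) (fun _ => norm_one) d).toContinuousLinearMap

theorem transl_apply (d : ℤ × ℤ) (u : EllTwo) (γ : ℤ × ℤ) : transl d u γ = u (γ - d) :=
  one_mul _

theorem norm_transl (d : ℤ × ℤ) (u : EllTwo) : ‖transl d u‖ = ‖u‖ :=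
  (phaseShift (fun _ => 1) (fun _ => norm_one) d).norm_map u

/-- The commutative algebra of Laurent polynomials in two variables. -/
abbrev Laurent : Type := AddMonoidAlgebra ℂ (ℤ × ℤ)

/-- Laurent polynomials act on `ℓ²(ℤ²)` by translations. -/
noncomputable def laurentRep : Laurent →ₐ[ℂ] (EllTwo →L[ℂ] EllTwo) :=
  AddMonoidAlgebra.lift ℂ _ _
    { toFun := fun d => transl d.toAdd
      map_one' := by
        ext u γ
        change transl 0 u γ = u γ
        rw [transl_apply, sub_zero]
      map_mul' := fun d e => by
        ext u γ
        change transl (d.toAdd + e.toAdd) u γ = transl d.toAdd (transl e.toAdd u) γ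
        rw [transl_apply, transl_apply, transl_apply, sub_sub] }

/-- The monomial of exponent `d`, as a unit. -/
noncomputable def monomialUnit (d : ℤ × ℤ) : Laurentˣ :=
  Units.map (AddMonoidAlgebra.of ℂ (ℤ × ℤ)) (toUnits (Multiplicative.ofAdd d))

theorem laurentRep_monomialUnit (d : ℤ × ℤ) : laurentRep (monomialUnit d : Laurent) = transl d :=
  AddMonoidAlgebra.lift_of _ _

theorem laurentRep_monomialUnit_inv (d : ℤ × ℤ) :
    laurentRep (↑(monomialUnit d)⁻¹ : Laurent) = transl (-d) :=
  AddMonoidAlgebra.lift_of _ _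

theorem laurentRep_algebraMap (c : ℂ) (u : EllTwo) :
    laurentRep (algebraMap ℂ Laurent c) u = c • u := by
  rw [AlgHom.commutes]
  rfl

theorem norm_laurentRep_inv {a : Laurentˣ} (ha : ∀ w, ‖laurentRep (a : Laurent) w‖ = ‖w‖)
    (w : EllTwo) : ‖laurentRep (↑a⁻¹ : Laurent) w‖ = ‖w‖ := by
  rw [← ha]
  change ‖(laurentRep (a : Laurent) * laurentRep (↑a⁻¹ : Laurent)) w‖ = ‖w‖
  rw [← map_mul, Units.mul_inv, map_one]
  rfl

theorem norm_laurentRep_monomial_pow_mul (d : ℤ × ℤ) (n : ℕ) {c : ℂ} (hc : ‖c‖ = 1) (w : EllTwo) :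
    ‖laurentRep ((monomialUnit d : Laurent) ^ n * algebraMap ℂ Laurent c) w‖ = ‖w‖ := by
  induction n with
  | zero => rw [pow_zero, one_mul, laurentRep_algebraMap, norm_smul, hc, one_mul]
  | succ n ih =>
    rw [pow_succ', mul_assoc, map_mul, laurentRep_monomialUnit]
    exact (norm_transl _ _).trans ih

theorem norm_det_cyc (m : ℕ) : ‖(cyc m).det‖ = 1 := by
  have h : (cyc m).det * (cyc m).det = 1 := by
    nth_rewrite 2 [← Matrix.det_transpose]
    rw [← Matrix.det_mul, cyc_mul_transpose, Matrix.det_one]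
  have h' := congrArg norm h
  rw [norm_mul, norm_one] at h'
  nlinarith [norm_nonneg (cyc m).det]

theorem norm_det_clock {m : ℕ} {ζ : ℂ} (hζ : ‖ζ‖ = 1) : ‖(clock m ζ).det‖ = 1 := by
  rw [clock, Matrix.det_diagonal, norm_prod]
  simp [hζ]

section Action

variable {m : ℕ}

/-- The action of matrices of Laurent polynomials on vectors of elements of `ℓ²(ℤ²)`. -/
noncomputable def matAct (A : Matrix (Fin (m + 1)) (Fin (m + 1)) Laurent)
    (v : Fin (m + 1) → EllTwo) (i : Fin (m + 1)) : EllTwo :=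
  ∑ k, laurentRep (A i k) (v k)

theorem matAct_mul (A B : Matrix (Fin (m + 1)) (Fin (m + 1)) Laurent)
    (v : Fin (m + 1) → EllTwo) : matAct (A * B) v = matAct A (matAct B v) := by
  ext1 i
  simp only [matAct, Matrix.mul_apply, map_sum, map_mul]
  rw [Finset.sum_comm]
  refine Finset.sum_congr rfl fun k _ => ?_
  rw [sum_apply]
  rfl

theorem matAct_sub (A B : Matrix (Fin (m + 1)) (Fin (m + 1)) Laurent)
    (v : Fin (m + 1) → EllTwo) : matAct (A - B) v = matAct A v - matAct B v := by
  ext1 i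
  simp only [matAct, Matrix.sub_apply, map_sub, Pi.sub_apply]
  rw [← Finset.sum_sub_distrib]
  rfl

theorem matAct_smul_one (c : Laurent) (v : Fin (m + 1) → EllTwo) (i : Fin (m + 1)) :
    matAct (c • (1 : Matrix (Fin (m + 1)) (Fin (m + 1)) Laurent)) v i = laurentRep c (v i) := by
  rw [matAct, Finset.sum_eq_single i]
  · simp
  · intro k _ hk
    simp [Matrix.one_apply_ne hk.symm]
  · simp

open Classical in
/-- The component of `u` on the sublattice `γ₁ ≡ j` modulo `m + 1`. -/
noncomputable def residuePart (j : Fin (m + 1)) (u : EllTwo) : EllTwo :=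
  mulLeOne (fun γ => if ((m + 1 : ℕ) : ℤ) ∣ γ.1 - (j : ℕ) then 1 else 0)
    (fun γ => by split_ifs <;> simp) u

open Classical in
theorem residuePart_apply (j : Fin (m + 1)) (u : EllTwo) (γ : ℤ × ℤ) :
    residuePart j u γ = if ((m + 1 : ℕ) : ℤ) ∣ γ.1 - (j : ℕ) then u γ else 0 := by
  change (if ((m + 1 : ℕ) : ℤ) ∣ γ.1 - (j : ℕ) then (1 : ℂ) else 0) * u γ = _
  split_ifs <;> simp

theorem norm_residuePart_le (j : Fin (m + 1)) (u : EllTwo) : ‖residuePart j u‖ ≤ ‖u‖ := by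
  classical
  have h : ENNReal.ofReal (‖residuePart j u‖ ^ 2) ≤ ENNReal.ofReal (‖u‖ ^ 2) := by
    rw [ofReal_norm_sq_eq_tsum, ofReal_norm_sq_eq_tsum]
    refine ENNReal.tsum_le_tsum fun γ => ENNReal.ofReal_le_ofReal ?_
    rw [residuePart_apply]
    split_ifs
    · exact le_rfl
    · simp
  rw [ENNReal.ofReal_le_ofReal_iff (sq_nonneg _)] at h
  exact le_of_sq_le_sq h (norm_nonneg _)

theorem residuePart_smul (j : Fin (m + 1)) (c : ℂ) (u : EllTwo) :
    residuePart j (c • u) = c • residuePart j u := by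
  ext γ
  change residuePart j (c • u) γ = c * residuePart j u γ
  rw [residuePart_apply, residuePart_apply, mul_ite, mul_zero]
  rfl

theorem residuePart_sub (j : Fin (m + 1)) (u v : EllTwo) :
    residuePart j (u - v) = residuePart j u - residuePart j v := by
  ext γ
  change residuePart j (u - v) γ = residuePart j u γ - residuePart j v γ
  rw [residuePart_apply, residuePart_apply, residuePart_apply]
  split_ifs
  · rfl
  · simp

theorem sum_residuePart (u : EllTwo) : ∑ j : Fin (m + 1), residuePart j u = u := by
  ext γ
  have hpos : (0 : ℤ) < ((m + 1 : ℕ) : ℤ) := by positivity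
  have h0 := Int.emod_nonneg γ.1 hpos.ne'
  have hlt := Int.emod_lt_of_pos γ.1 hpos
  have e : ∀ s : Finset (Fin (m + 1)), (∑ j ∈ s, residuePart j u) γ =
      ∑ j ∈ s, residuePart j u γ := fun s => by
    rw [lp.coeFn_sum, Finset.sum_apply]
  rw [e, Finset.sum_eq_single ⟨(γ.1 % ((m + 1 : ℕ) : ℤ)).toNat, by omega⟩]
  · rw [residuePart_apply, if_pos]
    simp only [Int.toNat_of_nonneg h0]
    exact Int.dvd_self_sub_emod
  · intro j _ hj
    rw [residuePart_apply, if_neg]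
    intro hd
    apply hj
    have h2 : γ.1 % ((m + 1 : ℕ) : ℤ) = ((j : ℕ) : ℤ) := by
      rw [Int.emod_eq_emod_iff_emod_sub_eq_zero.2 (Int.emod_eq_zero_of_dvd hd)]
      exact Int.emod_eq_of_lt (by positivity) (by exact_mod_cast j.2)
    refine Fin.ext ?_
    change (j : ℕ) = (γ.1 % ((m + 1 : ℕ) : ℤ)).toNat
    rw [h2, Int.toNat_natCast]
  · simp

theorem dvd_sub_val_add_one_iff (n : ℤ) (j : Fin (m + 1)) :
    ((m + 1 : ℕ) : ℤ) ∣ n + 1 - ((j + 1 : Fin (m + 1)) : ℕ) ↔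
      ((m + 1 : ℕ) : ℤ) ∣ n - (j : ℕ) := by
  have h : ((m + 1 : ℕ) : ℤ) ∣ ((j : ℕ) : ℤ) + 1 - ((j + 1 : Fin (m + 1)) : ℕ) := by
    rw [Fin.val_add, Fin.val_one']
    push_cast
    rw [Int.add_emod_emod]
    exact Int.dvd_self_sub_emod
  have e : n + 1 - (((j + 1 : Fin (m + 1)) : ℕ) : ℤ) =
      n - (j : ℕ) + (((j : ℕ) : ℤ) + 1 - ((j + 1 : Fin (m + 1)) : ℕ)) := by ring
  rw [e, dvd_add_left h]

theorem exp_eq_pow_of_dvd {Φ : ℝ} {ζ : ℂ} (hζ : ζ = Complex.exp (-(Φ : ℂ) * Complex.I))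
    (h1 : ζ ^ (m + 1) = 1) {n : ℤ} {j : ℕ} (hd : ((m + 1 : ℕ) : ℤ) ∣ n - (j : ℕ)) :
    Complex.exp (((-(Φ * (n : ℝ)) : ℝ) : ℂ) * Complex.I) = ζ ^ j := by
  have e : Complex.exp (((-(Φ * (n : ℝ)) : ℝ) : ℂ) * Complex.I) = ζ ^ n := by
    rw [hζ, ← Complex.exp_int_mul]
    congr 1
    push_cast
    ring
  have h0 : ζ ≠ 0 := by rw [hζ]; exact Complex.exp_ne_zero _
  obtain ⟨c, hc⟩ := hd
  have hn : n = ((m + 1 : ℕ) : ℤ) * c + (j : ℕ) := by linarith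
  rw [e, hn, zpow_add₀ h0, zpow_mul, zpow_natCast, h1, one_zpow, one_mul, zpow_natCast]

theorem matAct_bloch {Φ : ℝ} {ζ : ℂ} (hζ : ζ = Complex.exp (-(Φ : ℂ) * Complex.I))
    (h1 : ζ ^ (m + 1) = 1) (u : EllTwo) :
    matAct (bloch m ζ (monomialUnit (1, 0) : Laurent) (monomialUnit (0, 1) : Laurent))
      (fun j => residuePart j u) = fun j => residuePart j (hop Φ u) := by
  ext1 i
  have e : ∀ k, laurentRep (bloch m ζ (monomialUnit (1, 0) : Laurent)
      (monomialUnit (0, 1) : Laurent) i k) (residuePart k u) =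
      (if i = k then residuePart k u else 0) +
      (if i = k + 1 then transl (1, 0) (residuePart k u) else 0) +
      (if i = k then ζ ^ (i : ℕ) • transl (0, 1) (residuePart k u) else 0) := by
    intro k
    have e1 : laurentRep (bloch m ζ (monomialUnit (1, 0) : Laurent)
        (monomialUnit (0, 1) : Laurent) i k) = (if i = k then 1 else 0) +
        (if i = k + 1 then transl (1, 0) else 0) +
        (if i = k then ζ ^ (i : ℕ) • transl (0, 1) else 0) := by
      rw [bloch, Matrix.add_apply, Matrix.add_apply, map_add, map_add, Matrix.one_apply,
        Matrix.smul_apply, Matrix.smul_apply, Matrix.map_apply, Matrix.map_apply, smul_eq_mul,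
        smul_eq_mul, map_mul, map_mul, AlgHom.commutes, AlgHom.commutes, laurentRep_monomialUnit,
        laurentRep_monomialUnit, cyc, clock, Matrix.of_apply, Matrix.diagonal_apply]
      congr 1
      · congr 1
        · split_ifs <;> simp
        · split_ifs <;> simp
      · split_ifs
        · rw [← Algebra.commutes, ← Algebra.smul_def]
        · simp
    rw [e1]
    split_ifs <;> rfl
  rw [matAct, Finset.sum_congr rfl fun k _ => e k, Finset.sum_add_distrib, Finset.sum_add_distrib]
  have e2 : ∀ k, (i = k + 1) = (i - 1 = k) := fun k => propext sub_eq_iff_eq_add.symm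
  simp only [e2, Finset.sum_ite_eq, Finset.mem_univ, if_true]
  ext γ
  change residuePart i u γ + transl (1, 0) (residuePart (i - 1) u) γ +
    ζ ^ (i : ℕ) * transl (0, 1) (residuePart i u) γ = _
  rw [transl_apply, transl_apply, residuePart_apply, residuePart_apply, residuePart_apply,
    residuePart_apply, hop_apply]
  have e3 := dvd_sub_val_add_one_iff (γ.1 - 1) (i - 1)
  rw [sub_add_cancel, sub_add_cancel] at e3
  simp only [Prod.fst_sub, sub_zero, ← e3]
  by_cases hd : ((m + 1 : ℕ) : ℤ) ∣ γ.1 - (i : ℕ)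
  · simp only [if_pos hd]
    rw [exp_eq_pow_of_dvd hζ h1 hd]
  · simp only [if_neg hd, mul_zero, add_zero]

theorem matAct_blochAdj {Φ : ℝ} {ζ : ℂ} (hζ : ζ = Complex.exp (-(Φ : ℂ) * Complex.I))
    (h1 : ζ ^ (m + 1) = 1) (u : EllTwo) :
    matAct (blochAdj m ζ (↑(monomialUnit (1, 0))⁻¹ : Laurent) (↑(monomialUnit (0, 1))⁻¹ : Laurent))
      (fun j => residuePart j u) =
      fun j => residuePart j (ContinuousLinearMap.adjoint (hop Φ) u) := by
  ext1 i
  have e : ∀ k, laurentRep (blochAdj m ζ (↑(monomialUnit (1, 0))⁻¹ : Laurent)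
      (↑(monomialUnit (0, 1))⁻¹ : Laurent) i k) (residuePart k u) =
      (if i = k then residuePart k u else 0) +
      (if i + 1 = k then transl (-(1, 0)) (residuePart k u) else 0) +
      (if i = k then ζ⁻¹ ^ (i : ℕ) • transl (-(0, 1)) (residuePart k u) else 0) := by
    intro k
    have e1 : laurentRep (blochAdj m ζ (↑(monomialUnit (1, 0))⁻¹ : Laurent)
        (↑(monomialUnit (0, 1))⁻¹ : Laurent) i k) = (if i = k then 1 else 0) +
        (if i + 1 = k then transl (-(1, 0)) else 0) +
        (if i = k then ζ⁻¹ ^ (i : ℕ) • transl (-(0, 1)) else 0) := by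
      rw [blochAdj, Matrix.add_apply, Matrix.add_apply, map_add, map_add, Matrix.one_apply,
        Matrix.smul_apply, Matrix.smul_apply, Matrix.map_apply, Matrix.map_apply, smul_eq_mul,
        smul_eq_mul, map_mul, map_mul, AlgHom.commutes, AlgHom.commutes,
        laurentRep_monomialUnit_inv, laurentRep_monomialUnit_inv, cyc, clock,
        Matrix.transpose_apply, Matrix.of_apply, Matrix.diagonal_apply]
      have e0 : (k = i + 1) = (i + 1 = k) := propext eq_comm
      simp only [e0]
      congr 1
      · congr 1
        · split_ifs <;> simp
        · split_ifs <;> simp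
      · split_ifs
        · rw [← Algebra.commutes, ← Algebra.smul_def]
        · simp
    rw [e1]
    split_ifs <;> rfl
  rw [matAct, Finset.sum_congr rfl fun k _ => e k, Finset.sum_add_distrib, Finset.sum_add_distrib]
  simp only [Finset.sum_ite_eq, Finset.mem_univ, if_true]
  ext γ
  change residuePart i u γ + transl (-(1, 0)) (residuePart (i + 1) u) γ +
    ζ⁻¹ ^ (i : ℕ) * transl (-(0, 1)) (residuePart i u) γ = _
  rw [transl_apply, transl_apply, residuePart_apply, residuePart_apply, residuePart_apply,
    residuePart_apply, adjoint_hop_apply, sub_neg_eq_add, sub_neg_eq_add]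
  simp only [Prod.fst_add, add_zero, dvd_sub_val_add_one_iff]
  by_cases hd : ((m + 1 : ℕ) : ℤ) ∣ γ.1 - (i : ℕ)
  · simp only [if_pos hd]
    rw [inv_pow, ← exp_eq_pow_of_dvd hζ h1 hd, ← Complex.exp_neg]
    congr 3
    push_cast
    ring
  · simp only [if_neg hd, mul_zero, add_zero]

end Action

theorem norm_hop_le (Φ : ℝ) (u : EllTwo) : ‖hop Φ u‖ ≤ 3 * ‖u‖ := by
  have h1 : ‖tau0 u‖ = ‖u‖ := LinearIsometry.norm_map _ u
  have h2 : ‖tau1 Φ u‖ = ‖u‖ := LinearIsometry.norm_map _ u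
  calc ‖hop Φ u‖ = ‖u + tau0 u + tau1 Φ u‖ := rfl
    _ ≤ ‖u‖ + ‖tau0 u‖ + ‖tau1 Φ u‖ := norm_add₃_le
    _ = 3 * ‖u‖ := by rw [h1, h2]; ring

theorem norm_adjoint_hop_le (Φ : ℝ) (u : EllTwo) :
    ‖ContinuousLinearMap.adjoint (hop Φ) u‖ ≤ 3 * ‖u‖ := by
  refine ContinuousLinearMap.le_of_opNorm_le _ ?_ u
  rw [LinearIsometryEquiv.norm_map]
  exact ContinuousLinearMap.opNorm_le_bound _ (by norm_num) (norm_hop_le Φ)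

/-- Cramer's rule for the Bloch matrix of Laurent polynomials: the residual of `T T* - s²`
controls `u` as soon as the decoupled characteristic polynomial exceeds `8`, the norm of the
quasimomentum-dependent term in the Chambers formula. -/
theorem exists_residual_bound {m : ℕ} {Φ : ℝ} {ζ : ℂ}
    (hζ : ζ = Complex.exp (-(Φ : ℂ) * Complex.I)) (hprim : IsPrimitiveRoot ζ (m + 1)) (t : ℂ) :
    ∃ K, 0 ≤ K ∧ ∀ u : EllTwo, (‖(t • 1 - decoupled m ζ).det‖ - 8) * ‖u‖ ≤
      K * ‖t • u - hop Φ (ContinuousLinearMap.adjoint (hop Φ) u)‖ := by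
  have hζ1 : ‖ζ‖ = 1 := hprim.norm'_eq_one (by omega)
  set X := monomialUnit (1, 0)
  set Y := monomialUnit (0, 1)
  set N := algebraMap ℂ Laurent t • 1 -
    bloch m ζ (X : Laurent) Y * blochAdj m ζ (↑X⁻¹ : Laurent) ↑Y⁻¹ with hN
  obtain ⟨x, y, hx, hy, hdet⟩ := chambers (R := Laurent) hprim t X Y
  rw [← hN] at hdet
  have hxn : ∀ w, ‖laurentRep (x : Laurent) w‖ = ‖w‖ := fun w => by
    rw [hx]; exact norm_laurentRep_monomial_pow_mul _ _ (norm_det_cyc m) w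
  have hyn : ∀ w, ‖laurentRep (y : Laurent) w‖ = ‖w‖ := fun w => by
    rw [hy]; exact norm_laurentRep_monomial_pow_mul _ _ (norm_det_clock hζ1) w
  have hxi := norm_laurentRep_inv hxn
  have hyi := norm_laurentRep_inv hyn
  have hW : ∀ w, ‖laurentRep (2 + (x : Laurent) + y + ↑x⁻¹ + ↑y⁻¹ + x * ↑y⁻¹ + y * ↑x⁻¹) w‖ ≤
      8 * ‖w‖ := by
    intro w
    simp only [map_add, map_mul, map_ofNat]
    have h2 : ‖(2 : EllTwo →L[ℂ] EllTwo) w‖ ≤ 2 * ‖w‖ := by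
      have : (2 : EllTwo →L[ℂ] EllTwo) w = w + w := by
        have e : (2 : EllTwo →L[ℂ] EllTwo) = 1 + 1 := one_add_one_eq_two.symm
        rw [e]; rfl
      rw [this, two_mul]
      exact norm_add_le _ _
    have h3 : ‖laurentRep (x : Laurent) (laurentRep (↑y⁻¹ : Laurent) w)‖ = ‖w‖ := by
      rw [hxn, hyi]
    have h4 : ‖laurentRep (y : Laurent) (laurentRep (↑x⁻¹ : Laurent) w)‖ = ‖w‖ := by
      rw [hyn, hxi]
    have h5 := hxn w
    have h6 := hyn w
    have h7 := hxi w
    have h8 := hyi w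
    change ‖(2 : EllTwo →L[ℂ] EllTwo) w + laurentRep (x : Laurent) w + laurentRep (y : Laurent) w +
      laurentRep (↑x⁻¹ : Laurent) w + laurentRep (↑y⁻¹ : Laurent) w +
      laurentRep (x : Laurent) (laurentRep (↑y⁻¹ : Laurent) w) +
      laurentRep (y : Laurent) (laurentRep (↑x⁻¹ : Laurent) w)‖ ≤ _
    refine (norm_add_le _ _).trans ?_
    refine (add_le_add_left (norm_add_le _ _) _).trans ?_
    refine (add_le_add_left (add_le_add_left norm_add₃_le _) _).trans ?_
    have h9 := norm_add₃_le (a := (2 : EllTwo →L[ℂ] EllTwo) w) (b := laurentRep (x : Laurent) w)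
      (c := laurentRep (y : Laurent) w)
    linarith
  refine ⟨∑ i, ∑ k, ‖laurentRep (N.adjugate i k)‖,
    Finset.sum_nonneg fun i _ => Finset.sum_nonneg fun k _ => norm_nonneg _, fun u => ?_⟩
  set res := t • u - hop Φ (ContinuousLinearMap.adjoint (hop Φ) u) with hres
  have h1 : matAct N (fun j => residuePart j u) = fun j => residuePart j res := by
    rw [hN, matAct_sub, matAct_mul, matAct_blochAdj hζ hprim.pow_eq_one,
      matAct_bloch hζ hprim.pow_eq_one]
    ext1 j
    rw [Pi.sub_apply, matAct_smul_one, laurentRep_algebraMap, hres, residuePart_sub,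
      residuePart_smul]
  have h2 : ∀ i, laurentRep N.det (residuePart i u) =
      ∑ k, laurentRep (N.adjugate i k) (residuePart k res) := by
    intro i
    have h3 := congrFun (congrArg (matAct N.adjugate) h1) i
    rw [← matAct_mul, Matrix.adjugate_mul, matAct_smul_one] at h3
    exact h3
  have h3 : laurentRep N.det u = ∑ i, ∑ k, laurentRep (N.adjugate i k) (residuePart k res) := by
    conv_lhs => rw [← sum_residuePart (m := m) u, map_sum]
    exact Finset.sum_congr rfl fun i _ => h2 i
  have h4 : ‖laurentRep N.det u‖ ≤ (∑ i, ∑ k, ‖laurentRep (N.adjugate i k)‖) * ‖res‖ := by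
    rw [h3, Finset.sum_mul]
    refine (norm_sum_le _ _).trans (Finset.sum_le_sum fun i _ => ?_)
    rw [Finset.sum_mul]
    refine (norm_sum_le _ _).trans (Finset.sum_le_sum fun k _ => ?_)
    refine (ContinuousLinearMap.le_opNorm _ _).trans ?_
    gcongr
    exact norm_residuePart_le k res
  refine le_trans ?_ h4
  have h5 : laurentRep N.det u = (t • 1 - decoupled m ζ).det • u + (-1 : ℂ) ^ (m + 1) •
      laurentRep (2 + (x : Laurent) + y + ↑x⁻¹ + ↑y⁻¹ + x * ↑y⁻¹ + y * ↑x⁻¹) u := by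
    have h6 : ((-1 : Laurent)) ^ (m + 1) = algebraMap ℂ Laurent ((-1 : ℂ) ^ (m + 1)) := by
      rw [map_pow, map_neg, map_one]
    rw [hdet, h6, map_add, map_mul]
    change laurentRep _ u + laurentRep _ (laurentRep _ u) = _
    rw [laurentRep_algebraMap, laurentRep_algebraMap]
  have h6 : ‖(t • 1 - decoupled m ζ).det • u‖ ≤ ‖laurentRep N.det u‖ + 8 * ‖u‖ := by
    have h7 : (t • 1 - decoupled m ζ).det • u = laurentRep N.det u - (-1 : ℂ) ^ (m + 1) •
        laurentRep (2 + (x : Laurent) + y + ↑x⁻¹ + ↑y⁻¹ + x * ↑y⁻¹ + y * ↑x⁻¹) u := by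
      rw [h5, add_sub_cancel_right]
    rw [h7]
    refine (norm_sub_le _ _).trans (add_le_add le_rfl ?_)
    rw [norm_smul, norm_pow, norm_neg, norm_one, one_pow, one_mul]
    exact hW u
  rw [norm_smul] at h6
  linarith

/-- At rational flux the squares of the spectral values (times `9`) lie in the set where the
characteristic polynomial of the decoupled matrix is at most `8` in modulus. -/
theorem norm_det_decoupled_le_of_mem_spectrum {m : ℕ} {Φ : ℝ} {ζ : ℂ}
    (hζ : ζ = Complex.exp (-(Φ : ℂ) * Complex.I)) (hprim : IsPrimitiveRoot ζ (m + 1)) {l : ℝ}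
    (hl : (l : ℂ) ∈ spectrum ℂ (QLambda Φ)) :
    ‖((((3 * l) ^ 2 : ℝ) : ℂ) • 1 - decoupled m ζ).det‖ ≤ 8 := by
  by_cases hl0 : l = 0
  · rw [hl0]
    have h : ((((3 * 0) ^ 2 : ℝ) : ℂ) • 1 - decoupled m ζ) = -decoupled m ζ := by simp
    rw [h, det_neg_decoupled hprim, norm_pow, norm_neg, norm_one, one_pow]
    norm_num
  set s := 3 * l with hs
  have hs0 : 0 < |s| := abs_pos.2 (mul_ne_zero (by norm_num) hl0)
  obtain ⟨K, hK0, hK⟩ := exists_residual_bound hζ hprim ((s ^ 2 : ℝ) : ℂ)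
  by_contra! hlt
  set κ := ‖(((s ^ 2 : ℝ) : ℂ) • 1 - decoupled m ζ).det‖ - 8 with hκ
  have hκ0 : 0 < κ := by rw [hκ]; linarith
  set D := K * (3 + |s|) ^ 2 + κ with hD
  have hD0 : 0 < D := by positivity
  set η := |s| * κ / (2 * D) with hη
  have hη0 : 0 < η := by positivity
  obtain ⟨u, v, huv⟩ := exists_approx_pair_of_mem_spectrum hl hη0
  rw [← hs] at huv
  set a := hop Φ v - (s : ℂ) • u with ha
  set b := ContinuousLinearMap.adjoint (hop Φ) u - (s : ℂ) • v with hb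
  set n := ‖u‖ + ‖v‖ with hn
  have hab : ‖a‖ ^ 2 + ‖b‖ ^ 2 ≤ (η * n) ^ 2 := by
    refine huv.le.trans ?_
    rw [mul_pow]
    gcongr
    rw [hn]
    nlinarith [mul_nonneg (norm_nonneg u) (norm_nonneg v)]
  have hn0 : 0 < n := by
    by_contra! h
    have hu : ‖u‖ = 0 := by linarith [norm_nonneg u, norm_nonneg v]
    have hv : ‖v‖ = 0 := by linarith [norm_nonneg u, norm_nonneg v]
    rw [hu, hv] at huv
    nlinarith [sq_nonneg ‖a‖, sq_nonneg ‖b‖]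
  have ha' : ‖a‖ ≤ η * n := le_of_sq_le_sq (by nlinarith [sq_nonneg ‖b‖]) (by positivity)
  have hb' : ‖b‖ ≤ η * n := le_of_sq_le_sq (by nlinarith [sq_nonneg ‖a‖]) (by positivity)
  have hres : ((s ^ 2 : ℝ) : ℂ) • u - hop Φ (ContinuousLinearMap.adjoint (hop Φ) u) =
      -(hop Φ b) - (s : ℂ) • a := by
    rw [ha, hb, map_sub, map_smul, smul_sub, smul_smul]
    push_cast
    rw [sq]
    abel
  have h1 := hK u
  rw [hres] at h1
  have h2 : ‖-(hop Φ b) - (s : ℂ) • a‖ ≤ (3 + |s|) * (η * n) := by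
    refine (norm_sub_le _ _).trans ?_
    rw [norm_neg, norm_smul, Complex.norm_real, Real.norm_eq_abs, add_mul]
    refine add_le_add ((norm_hop_le Φ b).trans (by gcongr)) (by gcongr)
  have h3 : κ * ‖u‖ ≤ K * ((3 + |s|) * (η * n)) := h1.trans (by gcongr)
  have h4 : |s| * ‖v‖ ≤ η * n + 3 * ‖u‖ := by
    have h5 : (s : ℂ) • v = ContinuousLinearMap.adjoint (hop Φ) u - b := by rw [hb]; abel
    have h6 : |s| * ‖v‖ = ‖(s : ℂ) • v‖ := by
      rw [norm_smul, Complex.norm_real, Real.norm_eq_abs]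
    rw [h6, h5]
    refine (norm_sub_le _ _).trans ?_
    linarith [norm_adjoint_hop_le Φ u]
  have h5 : |s| * κ * n ≤ η * D * n := by
    have h6 : |s| * κ * n = |s| * (κ * ‖u‖) + κ * (|s| * ‖v‖) := by rw [hn]; ring
    have h7 : κ * (|s| * ‖v‖) ≤ κ * (η * n) + 3 * (κ * ‖u‖) := by nlinarith
    have h8 : (|s| + 3) * (κ * ‖u‖) ≤ (|s| + 3) * (K * ((3 + |s|) * (η * n))) := by gcongr
    calc |s| * κ * n ≤ (|s| + 3) * (K * ((3 + |s|) * (η * n))) + κ * (η * n) := by linarith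
      _ = η * D * n := by rw [hD]; ring
  have h6 : η * D = |s| * κ / 2 := by rw [hη]; field_simp
  rw [h6] at h5
  have : 0 < |s| * κ * n := by positivity
  linarith

/-! ### Covers and Hausdorff dimension -/

open MeasureTheory in
/-- A set with covers by `3 q` intervals of total length `B / q`, for arbitrarily large `q`, has
finite `1/2`-dimensional Hausdorff measure, by Cauchy–Schwarz. -/
theorem dimH_le_half_of_intervalCover {S : Set ℝ} {B : ℝ} {q : ℕ → ℕ}
    (hq : Tendsto q atTop atTop) (h : ∀ᶠ n in atTop, IntervalCover (3 * q n) (B / q n) S) :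
    dimH S ≤ 1 / 2 := by
  obtain ⟨N, hN⟩ := eventually_atTop.1 (h.and (hq.eventually_gt_atTop 0))
  set p : ℕ → ℕ := fun n => q (n + N) with hp
  have hp0 : ∀ n, 0 < p n := fun n => (hN (n + N) (by omega)).2
  have hpt : Tendsto p atTop atTop := hq.comp (tendsto_add_atTop_nat N)
  have hcov : ∀ n, IntervalCover (3 * p n) (B / p n) S := fun n => (hN (n + N) (by omega)).1
  choose k hk c d hcd hsum hS using hcov
  have hlim : Tendsto (fun n => ENNReal.ofReal (B / p n)) atTop (𝓝 0) := by
    rw [← ENNReal.ofReal_zero]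
    exact ENNReal.tendsto_ofReal
      (tendsto_const_nhds.div_atTop (tendsto_natCast_atTop_atTop.comp hpt))
  have hsingle : ∀ n i, d n i - c n i ≤ B / p n := fun n i =>
    (Finset.single_le_sum (f := fun i => d n i - c n i)
      (fun j _ => sub_nonneg.2 (hcd n j)) (Finset.mem_univ i)).trans (hsum n)
  have hH := Measure.hausdorffMeasure_le_liminf_sum (1 / 2 : ℝ) S
    (fun n => ENNReal.ofReal (B / p n)) hlim (fun n i => Set.Icc (c n i) (d n i))
    (Eventually.of_forall fun n i => by
      rw [Real.ediam_Icc]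
      exact ENNReal.ofReal_le_ofReal (hsingle n i))
    (Eventually.of_forall hS)
  have hbound : ∀ n, ∑ i, Metric.ediam (Set.Icc (c n i) (d n i)) ^ (1 / 2 : ℝ) ≤
      ENNReal.ofReal (√(3 * B)) := by
    intro n
    have hp' : (0 : ℝ) < p n := by exact_mod_cast hp0 n
    have e : ∀ i, Metric.ediam (Set.Icc (c n i) (d n i)) ^ (1 / 2 : ℝ) =
        ENNReal.ofReal (√(d n i - c n i)) := fun i => by
      rw [Real.ediam_Icc, ENNReal.ofReal_rpow_of_nonneg (sub_nonneg.2 (hcd n i)) (by norm_num),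
        Real.sqrt_eq_rpow]
    rw [Finset.sum_congr rfl fun i _ => e i,
      ← ENNReal.ofReal_sum_of_nonneg fun _ _ => Real.sqrt_nonneg _]
    refine ENNReal.ofReal_le_ofReal (Real.le_sqrt_of_sq_le ?_)
    have hcs := sq_sum_le_card_mul_sum_sq (s := (Finset.univ : Finset (Fin (k n))))
      (f := fun i => √(d n i - c n i))
    rw [Finset.card_univ, Fintype.card_fin,
      Finset.sum_congr rfl fun i _ => Real.sq_sqrt (sub_nonneg.2 (hcd n i))] at hcs
    refine hcs.trans ?_
    have hk' : (k n : ℝ) ≤ 3 * p n := by exact_mod_cast hk n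
    calc (k n : ℝ) * ∑ i, (d n i - c n i) ≤ 3 * p n * (B / p n) :=
          mul_le_mul hk' (hsum n) (Finset.sum_nonneg fun i _ => sub_nonneg.2 (hcd n i))
            (by positivity)
      _ = 3 * B := by field_simp
  have hfin : μH[((1 / 2 : NNReal) : ℝ)] S ≠ ⊤ := by
    have e : (((1 / 2 : NNReal)) : ℝ) = 1 / 2 := by norm_num
    rw [e]
    refine ne_top_of_le_ne_top (ENNReal.ofReal_ne_top (r := √(3 * B))) (hH.trans ?_)
    refine (liminf_le_liminf (Eventually.of_forall hbound)).trans ?_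
    rw [liminf_const]
  have := dimH_le_of_hausdorffMeasure_ne_top hfin
  simpa using this

theorem IntervalCover.thicken {n : ℕ} {L h : ℝ} {S : Set ℝ} (hS : IntervalCover n L S)
    (hh : 0 ≤ h) : IntervalCover n (L + 2 * n * h) {x | ∃ y ∈ S, |x - y| ≤ h} := by
  obtain ⟨k, hk, c, d, h1, h2, h3⟩ := hS
  refine ⟨k, hk, fun i => c i - h, fun i => d i + h, fun i => by linarith [h1 i], ?_, ?_⟩
  · have e : ∑ i, (d i + h - (c i - h)) = ∑ i, (d i - c i) + 2 * k * h := by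
      rw [Finset.sum_congr rfl fun i _ => show d i + h - (c i - h) = (d i - c i) + 2 * h by ring,
        Finset.sum_add_distrib, Finset.sum_const, Finset.card_univ, Fintype.card_fin,
        nsmul_eq_mul]
      ring
    rw [e]
    have hk' : (k : ℝ) ≤ n := by exact_mod_cast hk
    gcongr
  · rintro x ⟨y, hy, hxy⟩
    obtain ⟨i, hi⟩ := Set.mem_iUnion.1 (h3 hy)
    have := abs_le.1 hxy
    exact Set.mem_iUnion.2 ⟨i, by linarith [hi.1], by linarith [hi.2]⟩

theorem isPrimitiveRoot_exp_rat (r : ℚ) :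
    IsPrimitiveRoot (Complex.exp (-((2 * Real.pi * (r : ℝ) : ℝ) : ℂ) * Complex.I)) r.den := by
  have h := (Complex.isPrimitiveRoot_exp_rat r).inv
  have e : Complex.exp (-((2 * Real.pi * (r : ℝ) : ℝ) : ℂ) * Complex.I) =
      (Complex.exp (2 * Real.pi * Complex.I * r))⁻¹ := by
    rw [← Complex.exp_neg]
    congr 1
    push_cast
    ring
  rwa [e]

/-- The image of the spectrum under `λ ↦ (3 λ)²`. -/
def squaredSpectrum (Φ : ℝ) : Set ℝ :=
  {t | ∃ l : ℝ, (l : ℂ) ∈ spectrum ℂ (QLambda Φ) ∧ t = (3 * l) ^ 2}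

/-- Near a rational flux `2π p / q` the set `squaredSpectrum` is covered by `3 q` intervals: those
at the rational flux, enlarged by the Hölder distance. -/
theorem intervalCover_squaredSpectrum {Φ : ℝ} (r : ℚ) (hne : Φ ≠ 2 * Real.pi * r)
    (hle : |Φ - 2 * Real.pi * r| ≤ 1) :
    IntervalCover (3 * r.den) (32 / r.den + 2 * (3 * r.den : ℕ) *
      ((6 * ‖QLambda Φ‖ + 8) * (8 * √|Φ - 2 * Real.pi * r|))) (squaredSpectrum Φ) := by
  obtain ⟨m, hm⟩ : ∃ m, r.den = m + 1 := ⟨r.den - 1, by have := r.den_pos; omega⟩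
  have hprim := isPrimitiveRoot_exp_rat r
  rw [hm] at hprim ⊢
  have hcov := (intervalCover_det_decoupled_le hprim).thicken
    (h := (6 * ‖QLambda Φ‖ + 8) * (8 * √|Φ - 2 * Real.pi * r|)) (by positivity)
  refine hcov.mono le_rfl (by push_cast; exact le_rfl) ?_
  rintro t ⟨l, hl, rfl⟩
  obtain ⟨l', hl', hll⟩ := exists_mem_spectrum_near hne hle hl
  refine ⟨(3 * l') ^ 2, norm_det_decoupled_le_of_mem_spectrum rfl hprim hl', ?_⟩
  have hl1 : |l| ≤ ‖QLambda Φ‖ := by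
    have h1 := spectrum.norm_le_norm_mul_of_mem hl
    rw [Complex.norm_real, Real.norm_eq_abs] at h1
    exact h1.trans (mul_le_of_le_one_right (norm_nonneg _) ContinuousLinearMap.norm_id_le)
  have hsq : √|Φ - 2 * Real.pi * r| ≤ 1 := Real.sqrt_le_one.2 hle
  have e : (3 * l) ^ 2 - (3 * l') ^ 2 = (6 * l - (3 * l - 3 * l')) * (3 * l - 3 * l') := by ring
  rw [e, abs_mul]
  gcongr
  refine (abs_sub _ _).trans ?_
  rw [abs_mul, abs_of_pos (by norm_num : (0 : ℝ) < 6)]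
  linarith

theorem dimH_squaredSpectrum_le {Φ : ℝ} (hΦ : IsGenericFlux Φ) :
    dimH (squaredSpectrum Φ) ≤ 1 / 2 := by
  obtain ⟨hirr, C, r, hr, hC⟩ := hΦ
  have hpi := Real.pi_pos
  have hC0 : 0 < C := (by positivity : (0 : ℝ) ≤ _).trans_lt (hC 0)
  set A := (6 * ‖QLambda Φ‖ + 8) * 8 with hA
  set E := √(2 * Real.pi * C) with hE
  refine dimH_le_half_of_intervalCover (B := 32 + 6 * (A * E)) hr ?_
  have hlarge : ∀ᶠ n in atTop, 2 * Real.pi * C ≤ (r n).den :=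
    (tendsto_natCast_atTop_atTop.comp hr).eventually_ge_atTop _
  filter_upwards [hlarge] with n hn
  set q : ℝ := ((r n).den : ℝ) with hq
  have hq1 : 1 ≤ q := by rw [hq]; exact_mod_cast (r n).den_pos
  have hq0 : 0 < q := by linarith
  have hdist : |Φ - 2 * Real.pi * r n| ≤ 2 * Real.pi * C / q ^ 4 := by
    have e : Φ - 2 * Real.pi * r n = 2 * Real.pi * (Φ / (2 * Real.pi) - r n) := by
      field_simp
    rw [e, abs_mul, abs_of_pos (by positivity : 0 < 2 * Real.pi), le_div_iff₀ (by positivity)]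
    have := (hC n).le
    calc 2 * Real.pi * |Φ / (2 * Real.pi) - r n| * q ^ 4 =
          2 * Real.pi * (q ^ 4 * |Φ / (2 * Real.pi) - r n|) := by ring
      _ ≤ 2 * Real.pi * C := by gcongr
  have hle : |Φ - 2 * Real.pi * r n| ≤ 1 := by
    refine hdist.trans ?_
    rw [div_le_one (by positivity)]
    exact hn.trans (le_self_pow₀ hq1 (by norm_num))
  have hne : Φ ≠ 2 * Real.pi * r n := by
    intro h
    refine hirr.ne_rat (r n) ?_
    rw [h]
    field_simp
  have hs : √|Φ - 2 * Real.pi * r n| ≤ E / q ^ 2 := by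
    refine (Real.sqrt_le_sqrt hdist).trans_eq ?_
    rw [Real.sqrt_div (by positivity), show q ^ 4 = (q ^ 2) ^ 2 by ring,
      Real.sqrt_sq (by positivity)]
  refine (intervalCover_squaredSpectrum (r n) hne hle).mono le_rfl ?_ subset_rfl
  rw [← mul_assoc (6 * ‖QLambda Φ‖ + 8), ← hA]
  push_cast
  rw [← hq]
  calc 32 / q + 2 * (3 * q) * (A * √|Φ - 2 * Real.pi * r n|) ≤
        32 / q + 2 * (3 * q) * (A * (E / q ^ 2)) := by gcongr
    _ = (32 + 6 * (A * E)) / q := by field_simp; ring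

/-- The spectrum is recovered from `squaredSpectrum` by the two branches of the square root, which
are locally Lipschitz away from `0`. -/
theorem dimH_spectrum_le_dimH_squaredSpectrum (Φ : ℝ) :
    dimH (spectrum ℂ (QLambda Φ)) ≤ dimH (squaredSpectrum Φ) := by
  have hbranch : ∀ c : ℝ, dimH ((fun t : ℝ => ((c * √t : ℝ) : ℂ)) ''
      (squaredSpectrum Φ ∩ Set.Ioi 0)) ≤ dimH (squaredSpectrum Φ) := by
    intro c
    refine (dimH_image_le_of_locally_lipschitzOn fun t ht => ?_).trans
      (dimH_mono Set.inter_subset_left)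
    have hsm : ContDiffAt ℝ 1 (fun t : ℝ => ((c * √t : ℝ) : ℂ)) t :=
      Complex.ofRealCLM.contDiff.contDiffAt.comp t
        (contDiffAt_const.mul (Real.contDiffAt_sqrt (ne_of_gt ht.2)))
    obtain ⟨K, s, hs, hK⟩ := hsm.exists_lipschitzOnWith
    exact ⟨K, s, mem_nhdsWithin_of_mem_nhds hs, hK⟩
  have hsub : spectrum ℂ (QLambda Φ) ⊆ {0} ∪
      (((fun t : ℝ => (((1 / 3) * √t : ℝ) : ℂ)) '' (squaredSpectrum Φ ∩ Set.Ioi 0)) ∪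
      ((fun t : ℝ => (((-1 / 3) * √t : ℝ) : ℂ)) '' (squaredSpectrum Φ ∩ Set.Ioi 0))) := by
    intro z hz
    have hzr := (isSelfAdjoint_QLambda Φ).mem_spectrum_eq_re hz
    set l := z.re with hl
    rw [hzr] at hz ⊢
    have hmem : (3 * l) ^ 2 ∈ squaredSpectrum Φ := ⟨l, hz, rfl⟩
    rcases lt_trichotomy l 0 with h | h | h
    · refine Or.inr (Or.inr ⟨(3 * l) ^ 2, ⟨hmem, ?_⟩, ?_⟩)
      · exact Set.mem_Ioi.2 (by nlinarith)
      · have : √((3 * l) ^ 2) = -(3 * l) := by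
          rw [Real.sqrt_sq_eq_abs, abs_of_neg (by linarith)]
        simp only [this]
        congr 1
        ring
    · left
      rw [h]
      simp
    · refine Or.inr (Or.inl ⟨(3 * l) ^ 2, ⟨hmem, ?_⟩, ?_⟩)
      · exact Set.mem_Ioi.2 (by positivity)
      · have : √((3 * l) ^ 2) = 3 * l := Real.sqrt_sq (by linarith)
        simp only [this]
        congr 1
        ring
  refine (dimH_mono hsub).trans ?_
  rw [dimH_union, dimH_union, dimH_singleton]
  exact max_le zero_le (max_le (hbranch _) (hbranch _))

end HexQ

theorem mainTheorem10 :
    (∀ᶠ Φ : ℝ in residual ℝ, HexQ.IsGenericFlux Φ) ∧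
      ∀ Φ : ℝ, HexQ.IsGenericFlux Φ →
        dimH (spectrum ℂ (HexQ.QLambda Φ)) ≤ 1 / 2 :=
  ⟨HexQ.eventually_residual_isGenericFlux, fun Φ hΦ =>
    (HexQ.dimH_spectrum_le_dimH_squaredSpectrum Φ).trans (HexQ.dimH_squaredSpectrum_le hΦ)⟩
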